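/- **Setting.** A polytope $P\subset\mathbb R^3$ is the convex hull of a finite set, with non-empty interior. Its facets and edges are its two- and one-dimensional faces. If $P$ is centrally symmetric, the opposite facet of a facet $F$ is the image of $F$ under the reflection in the center of $P$. A multiset $\Lambda$ of points of $\mathbb R^3$ (each point with a finite multiplicity) makes $P$ tile at level $k$ if $\sum_{\lambda\in\Lambda}\mathbf 1_{P+\lambda}(x)=k$ for almost every $x\in\mathbb R^3$. Let $\delta_\Lambda=\sum_{\lambda\in\Lambda}\delta_\lambda$, where $\delta_\lambda$ is the unit point mass at $\lambda$; Fourier transforms are normalized by $\widehat f(u)=\int f(x)e^{-2\pi i\langle u,x\rangle}\,dx$. A *4-legged frame* of $P$ consists of vectors $(\mathbf e,\tau_1,\tau_2)$ such that, for some segment $[e]$ with direction and length given by $\mathbf e$ (that is, $[e]=[a,a+\mathbf e]$ for some point $a$), the four segments $[e]$, $[e]+\tau_1$, $[e]+\tau_2$, $[e]+\tau_1+\tau_2$ are distinct edges of $P$, the first two contained in one facet of $P$ and the last two contained in the opposite facet. For a non-zero vector $\mathbf x\in\mathbb R^3$ put $\mathbf x^*=\mathbf x/|\mathbf x|^2$,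 let $\mathbf x^\perp$ be the plane through $0$ orthogonal to $\mathbf x$, and let $$\mathbb H(\mathbf x)=\mathbb Z\,\mathbf x^*+\mathbf x^\perp,\qquad \mathbb H_{-0}(\mathbf x)=(\mathbb Z\setminus\{0\})\,\mathbf x^*+\mathbf x^\perp .$$ **Theorem.** Let $P\subset\mathbb R^3$ be a centrally symmetric polytope with centrally symmetric facets, let $k$ be a positive integer, and let $\Lambda$ be a multiset of points of $\mathbb R^3$ such that $P$ tiles at level $k$ when translated by $\Lambda$. Then $\delta_\Lambda$ is a tempered distribution, and $$\operatorname{supp}\widehat{\delta_\Lambda}\subseteq\{0\}\cup\bigcap_{(\mathbf e,\tau_1,\tau_2)}\bigl(\mathbb H_{-0}(\mathbf e)\cup\mathbb H(\tau_1)\cup\mathbb H(\tau_2)\bigr),$$ where the intersection is taken over all 4-legged frames $(\mathbf e,\tau_1,\tau_2)$ of $P$. -/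

import Mathlib

open MeasureTheory
open scoped Pointwise ENNReal FourierTransform SchwartzMap

noncomputable section

/-- Euclidean three-space. -/
abbrev E3 := EuclideanSpace ℝ (Fin 3)

/-- A (full-dimensional, convex) polytope in `ℝ³`: the convex hull of a finite set of points,
with non-empty interior. -/
def IsPolytope (P : Set E3) : Prop :=
  (∃ V : Set E3, V.Finite ∧ P = convexHull ℝ V) ∧ (interior P).Nonempty

/-- `c` is a center of symmetry of `S`. -/
def IsCenterOf (c : E3) (S : Set E3) : Prop :=
  Equiv.pointReflection c '' S = S

/-- Central symmetry, about some center. -/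
def IsCentrallySymmetric (S : Set E3) : Prop :=
  ∃ c : E3, IsCenterOf c S

/-- `F` is a `d`-dimensional face of `P`: the non-empty set of points of `P` where some linear
functional attains its maximum over `P`, with affine span of dimension `d`. -/
def IsFaceOfDim (P : Set E3) (d : ℕ) (F : Set E3) : Prop :=
  F.Nonempty ∧ IsExposed ℝ P F ∧ Module.finrank ℝ (vectorSpan ℝ F) = d

/-- The facets of `P`, that is, its two-dimensional faces. -/
def IsFacet (P F : Set E3) : Prop := IsFaceOfDim P 2 F

/-- The edges of `P`, that is, its one-dimensional faces. -/
def IsEdge (P L : Set E3) : Prop := IsFaceOfDim P 1 L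

/-- A multiset `Λ` of points of `ℝ³` is given by its multiplicity function. The set `P` tiles at
level `k` when translated by `Λ` if `∑_{v ∈ Λ} 1_{P + v}(x) = k` for almost every `x`. -/
def TilesAtLevel (P : Set E3) (Λ : E3 → ℕ) (k : ℕ) : Prop :=
  ∀ᵐ x : E3, ∑' v : E3, (Λ v : ℝ≥0∞) * (v +ᵥ P).indicator (fun _ => (1 : ℝ≥0∞)) x = (k : ℝ≥0∞)

/-- The measure `δ_Λ = ∑_{v ∈ Λ} δ_v`, with multiplicities. -/
def deltaMeasure (Λ : E3 → ℕ) : Measure E3 :=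
  Measure.sum fun v : E3 => (Λ v : ℝ≥0∞) • Measure.dirac v

/-- `(e, τ₁, τ₂)` are the vectors of a `4`-legged frame of `P`: for some point `a`, writing `[e]`
for the segment from `a` to `a + e`, the segments `[e]`, `[e] + τ₁`, `[e] + τ₂` and
`[e] + τ₁ + τ₂` are four different edges of `P`, the first two of them lie in a facet `F` of `P`
and the last two lie in the opposite facet, the mirror image of `F` in the center `c` of `P`. -/
def IsFourLeggedFrame (P : Set E3) (e τ₁ τ₂ : E3) : Prop :=
  ∃ (a c : E3) (F : Set E3),
    IsCenterOf c P ∧ IsFacet P F ∧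
    (IsEdge P (segment ℝ a (a + e)) ∧
      IsEdge P (τ₁ +ᵥ segment ℝ a (a + e)) ∧
      IsEdge P (τ₂ +ᵥ segment ℝ a (a + e)) ∧
      IsEdge P ((τ₁ + τ₂) +ᵥ segment ℝ a (a + e))) ∧
    (τ₁ ≠ 0 ∧ τ₂ ≠ 0 ∧ τ₁ ≠ τ₂ ∧ τ₁ + τ₂ ≠ 0) ∧
    (segment ℝ a (a + e) ⊆ F ∧ τ₁ +ᵥ segment ℝ a (a + e) ⊆ F) ∧
    (τ₂ +ᵥ segment ℝ a (a + e) ⊆ Equiv.pointReflection c '' F ∧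
      (τ₁ + τ₂) +ᵥ segment ℝ a (a + e) ⊆ Equiv.pointReflection c '' F)

/-- The geometric inverse `x* = x / |x|²`. -/
def geomInverse (x : E3) : E3 := (‖x‖ ^ 2)⁻¹ • x

/-- The planes `ℤ x* + x^⊥`. -/
def planes (x : E3) : Set E3 :=
  {u | ∃ n : ℤ, ∃ w ∈ (Submodule.span ℝ {x})ᗮ, u = (n : ℝ) • geomInverse x + w}

/-- The planes `(ℤ \ {0}) x* + x^⊥`. -/
def planesNonzero (x : E3) : Set E3 :=
  {u | ∃ n : ℤ, n ≠ 0 ∧ ∃ w ∈ (Submodule.span ℝ {x})ᗮ, u = (n : ℝ) • geomInverse x + w}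

end

/-!
Suppose that four parallel edges `E`, `E + τ₁`, `E + τ₂`, `E + τ₁ + τ₂` of `P` form a frame. The
heart of the proof is that, in a multiple tiling, the signed measure
`σ_E - σ_{E + τ₁} - σ_{E + τ₂} + σ_{E + τ₁ + τ₂}`, where `σ` is arc length, is annihilated by
convolution with `δ_Λ`. On the Fourier side this says that `𝓕 δ_Λ` is annihilated by the smooth
function `frameFactor`, which is the product of a character, of the Fourier transform of the unit
interval at `⟨e, u⟩` and of `1 - exp (-2πi⟨τ₁, u⟩)` and `1 - exp (-2πi⟨τ₂, u⟩)`. These factors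
vanish on `planesNonzero e`, `planes τ₁` and `planes τ₂` only, and a test function supported away
from the zeros can be divided by `frameFactor`; hence `𝓕 δ_Λ` vanishes off them
(`notMem_dsupport_of_frameFactor_ne_zero`).

The cancellation is obtained point by point. Let `N` be a functional that exposes the facet of the
frame, let `f` be a vector that lies in the plane of the facet and points away from `E`, and let
`n` be transversal to that plane. For a point `z` on a line parallel to `E`, outside a null set of
the line, consider the alternating sum of the indicator function of `P` over the four points
`z ± δ f ± η n` with `0 < η ≪ δ ≪ 1`. First, the jump of the indicator function across the plane
`N = const` is `-1` on the facet where `N` is maximal, `1` on the facet where it is minimal, and `0`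
at other points off the relative boundary of the slice (`jump_across_hyperplane`). The jump of the
indicator function of a slice across the line is likewise seen only on the two edges of the slice
parallel to `E` (`slice_jump`). Together, the alternating sum counts exactly the four legs of the
frame, with signs `-`, `+`, `+`, `-` (`eventually_altSum_eq`). This uses of `P` only its convexity
and that the two extremal faces are two-dimensional; no description of `P` by its facets is needed.
Summing over the translates of `P`, each of the four points is covered `k` times, and the
alternating sum `k - k - k + k` is zero (`TilesAtLevel.ae_coverCount_add_eq`). Since the measure on
the translates of a leg has the number of translates through a point as its density, up to a
constant, with respect to one-dimensional Hausdorff measure, the four measures cancel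
(`legMeasure_add_eq`).

That `δ_Λ` is tempered follows by comparing the value of `(1 + ‖x‖)⁻⁴` at `v ∈ Λ` with its integral
over `v + P`: the tiling property sums these integrals (`TilesAtLevel.hasTemperateGrowth`).
-/

/-! ### Convex sets near a point of a hyperplane -/

section LocalGeometry

open Filter Topology Set

/-- The integer-valued indicator function of a set. -/
noncomputable abbrev ind {X : Type*} (S : Set X) (x : X) : ℤ := S.indicator 1 x

lemma ind_of_mem {X : Type*} {S : Set X} {x : X} (h : x ∈ S) : ind S x = 1 := by simp [ind, h]

lemma ind_of_notMem {X : Type*} {S : Set X} {x : X} (h : x ∉ S) : ind S x = 0 := by simp [ind, h]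

lemma ind_congr {X : Type*} {S T : Set X} {x : X} (h : x ∈ S ↔ x ∈ T) : ind S x = ind T x := by
  by_cases hx : x ∈ T
  · rw [ind_of_mem hx, ind_of_mem (h.2 hx)]
  · rw [ind_of_notMem hx, ind_of_notMem (fun hS => hx (h.1 hS))]

variable {V : Type*} [NormedAddCommGroup V] [NormedSpace ℝ V]

/-- `w` is a radial (algebraic) interior point of the slice of `P` through `w` parallel to the
hyperplane `N = 0`. -/
def IsRadial (N : StrongDual ℝ V) (P : Set V) (w : V) : Prop :=
  ∀ u, N u = 0 → ∀ᶠ t : ℝ in 𝓝 0, w + t • u ∈ P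

lemma IsRadial.mem {N : StrongDual ℝ V} {P : Set V} {w : V} (h : IsRadial N P w) : w ∈ P := by
  simpa using (h 0 (map_zero N)).self_of_nhds

lemma IsRadial.neg {N : StrongDual ℝ V} {P : Set V} {w : V} (h : IsRadial N P w) :
    IsRadial (-N) P w :=
  fun u hu => h u (by simpa using hu)

lemma IsRadial.combo {N : StrongDual ℝ V} {P : Set V} (hP : Convex ℝ P) {p q : V}
    (hp : IsRadial N P p) (hq : q ∈ P) {a b : ℝ} (ha : 0 < a) (hb : 0 ≤ b) (hab : a + b = 1) :
    IsRadial N P (a • p + b • q) := by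
  intro u hu
  have ht : Tendsto (fun t : ℝ => t / a) (𝓝 0) (𝓝 0) := by
    simpa using (tendsto_id (x := 𝓝 (0 : ℝ))).div_const a
  filter_upwards [ht.eventually (hp u hu)] with t h
  have := hP h hq ha.le hb hab
  convert this using 1
  rw [smul_add, smul_smul, mul_div_cancel₀ _ ha.ne']
  abel

lemma isRadial_of_mem_interior (N : StrongDual ℝ V) {P : Set V} {w : V} (h : w ∈ interior P) :
    IsRadial N P w := by
  intro u _
  have ht : Tendsto (fun t : ℝ => w + t • u) (𝓝 0) (𝓝 w) := by
    have : Continuous (fun t : ℝ => w + t • u) := by fun_prop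
    simpa using this.tendsto 0
  exact ht.eventually (mem_interior_iff_mem_nhds.1 h)

/-- A point of `P` whose level for `N` contains no interior point of `P` lies in the face of `P`
where `N` is maximal or in the one where it is minimal. -/
lemma mem_toExposed_or_of_forall_ne {N : StrongDual ℝ V} {P : Set V} (hP : Convex ℝ P)
    (hne : (interior P).Nonempty) {w : V} (hw : w ∈ P) (h : ∀ p ∈ interior P, N p ≠ N w) :
    w ∈ N.toExposed P ∨ w ∈ (-N).toExposed P := by
  obtain ⟨p, hp⟩ := hne
  have cross : ∀ q ∈ P, ¬ (N p < N w ∧ N w < N q) ∧ ¬ (N q < N w ∧ N w < N p) := by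
    intro q hq
    have key : (N w - N p) / (N q - N p) ≤ 0 ∨ 1 ≤ (N w - N p) / (N q - N p) ∨ N q = N p := by
      by_contra! hcon
      obtain ⟨h0, h1, h2⟩ := hcon
      set θ := (N w - N p) / (N q - N p) with hθ
      have hmem : (1 - θ) • p + θ • q ∈ interior P :=
        hP.combo_interior_self_mem_interior hp hq (by linarith) h0.le (by ring)
      refine h _ hmem ?_
      have : N q - N p ≠ 0 := sub_ne_zero.2 h2
      simp only [map_add, map_smul, smul_eq_mul, hθ]
      field_simp
      ring
    constructor
    · rintro ⟨h1, h2⟩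
      rcases key with k | k | k
      · exact absurd k (not_le.2 (div_pos (by linarith) (by linarith)))
      · rw [le_div_iff₀ (by linarith)] at k; linarith
      · linarith
    · rintro ⟨h1, h2⟩
      rcases key with k | k | k
      · exact absurd k (not_le.2 (div_pos_of_neg_of_neg (by linarith) (by linarith)))
      · rw [le_div_iff_of_neg (by linarith)] at k; linarith
      · linarith
  rcases lt_or_gt_of_ne (h p hp) with hlt | hlt
  · left
    refine ⟨hw, fun q hq => ?_⟩
    by_contra! hq'
    exact (cross q hq).1 ⟨hlt, hq'⟩
  · right
    refine ⟨hw, fun q hq => ?_⟩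
    by_contra! hq'
    simp only [neg_apply, neg_lt_neg_iff] at hq'
    exact (cross q hq).2 ⟨hq', hlt⟩

lemma IsRadial.trichotomy {N : StrongDual ℝ V} {P : Set V} (hP : Convex ℝ P)
    (hne : (interior P).Nonempty) {w : V} (hw : IsRadial N P w) :
    w ∈ interior P ∨ w ∈ N.toExposed P ∨ w ∈ (-N).toExposed P := by
  by_cases h : ∃ p ∈ interior P, N p = N w
  · left
    obtain ⟨p, hp, hpw⟩ := h
    have h1 := (hw (w - p) (by simp [hpw])).filter_mono (nhdsWithin_le_nhds (s := Ioi 0))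
    obtain ⟨t, ht, htpos⟩ := (h1.and self_mem_nhdsWithin).exists
    have htpos : 0 < t := htpos
    have := hP.combo_interior_self_mem_interior hp ht (a := t / (1 + t)) (b := 1 / (1 + t))
      (by positivity) (by positivity) (by field_simp; ring)
    convert this using 1
    have h1t : (1 + t) ≠ 0 := by positivity
    rw [← smul_right_injective V h1t |>.eq_iff]
    simp only [smul_add, smul_smul, smul_sub]
    field_simp
    module
  · push Not at h
    exact Or.inr (mem_toExposed_or_of_forall_ne hP hne hw.mem h)

lemma eventually_eventually_mem {A : Set V} {w n : V}
    (h : ∀ᶠ η : ℝ in 𝓝[>] 0, w + η • n ∈ interior A) :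
    ∀ᶠ η : ℝ in 𝓝[>] 0, ∀ᶠ y in 𝓝 (0 : V), w + y + η • n ∈ A := by
  filter_upwards [h] with η hη
  have ht : Tendsto (fun y : V => w + y + η • n) (𝓝 0) (𝓝 (w + η • n)) := by
    have : Continuous (fun y : V => w + y + η • n) := by fun_prop
    simpa using this.tendsto 0
  exact ht.eventually (mem_interior_iff_mem_nhds.1 hη)

lemma eventually_mem_of_mem_open {A : Set V} {w : V} (hA : IsOpen A) (hw : w ∈ A) (n : V) :
    ∀ᶠ η : ℝ in 𝓝[>] 0, w + η • n ∈ A := by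
  have ht : Tendsto (fun t : ℝ => w + t • n) (𝓝 0) (𝓝 w) := by
    have : Continuous (fun t : ℝ => w + t • n) := by fun_prop
    simpa using this.tendsto 0
  exact (ht.eventually (hA.mem_nhds hw)).filter_mono nhdsWithin_le_nhds

/-- Below a relative interior point of the face where `N` is maximal lie interior points. -/
lemma eventually_mem_interior_of_isRadial {N : StrongDual ℝ V} {P : Set V} (hP : Convex ℝ P)
    (hne : (interior P).Nonempty) {w n : V} (hn : 0 < N n) (hw : IsRadial N P w)
    (hwF : w ∈ N.toExposed P) : ∀ᶠ η : ℝ in 𝓝[>] 0, w + η • (-n) ∈ interior P := by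
  obtain ⟨p, hp⟩ := hne
  have hlt : N p < N w := by
    obtain ⟨t, ht, htpos⟩ :=
      ((eventually_mem_of_mem_open isOpen_interior hp n).and self_mem_nhdsWithin).exists
    have h1 := hwF.2 _ (interior_subset ht)
    have htpos : 0 < t := htpos
    simp only [map_add, map_smul, smul_eq_mul] at h1
    nlinarith [mul_pos htpos hn]
  set h := (N w - N p) / N n with hh
  have hpos : 0 < h := div_pos (by linarith) hn
  have hu : N (p - w + h • n) = 0 := by
    simp only [map_add, map_sub, map_smul, smul_eq_mul, hh]
    field_simp
    ring
  have ht : Tendsto (fun η : ℝ => -((η / h) / (1 - η / h))) (𝓝[>] 0) (𝓝 0) := by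
    have : ContinuousAt (fun η : ℝ => -((η / h) / (1 - η / h))) 0 := by
      refine ContinuousAt.neg (ContinuousAt.div ?_ ?_ (by simp)) <;> fun_prop
    have h2 := this.tendsto
    simp only [zero_div, neg_zero] at h2
    exact h2.mono_left nhdsWithin_le_nhds
  filter_upwards [ht.eventually (hw _ hu), self_mem_nhdsWithin,
    Ioo_mem_nhdsGT hpos] with η hη hη0 hη1
  have h0 : 0 < η / h := div_pos hη0 hpos
  have h1 : η / h < 1 := (div_lt_one hpos).2 hη1.2
  have := hP.combo_self_interior_mem_interior hη hp (a := 1 - η / h) (b := η / h)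
    (by linarith) h0 (by ring)
  convert this using 1
  have e1 : (1 - η / h) ≠ 0 := by linarith
  have e2 : (1 - η / h) * (-((η / h) / (1 - η / h))) = -(η / h) := by
    rw [mul_neg, mul_div_cancel₀ _ e1]
  rw [smul_add, smul_smul, e2]
  have e3 : (η / h) • (h • n) = η • n := by rw [smul_smul]; congr 1; field_simp
  rw [smul_add, neg_smul, neg_smul, e3]
  module

lemma eventually_notMem_of_mem_toExposed {N : StrongDual ℝ V} {P : Set V} (hc : IsClosed P)
    {w n : V} (hn : 0 < N n) (hwF : w ∈ N.toExposed P) :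
    ∀ᶠ η : ℝ in 𝓝[>] 0, w + η • n ∈ interior Pᶜ := by
  filter_upwards [self_mem_nhdsWithin] with η hη
  rw [hc.isOpen_compl.interior_eq]
  intro hmem
  have h1 := hwF.2 _ hmem
  have hη : 0 < η := hη
  simp only [map_add, map_smul, smul_eq_mul] at h1
  nlinarith [mul_pos hη hn]

/-- The jump of the indicator function of a convex body across a hyperplane `N = const`, at a point
which is not on the relative boundary of the slice: it is `-1` on the face where `N` is maximal,
`1` on the face where `N` is minimal, and `0` elsewhere. -/
lemma jump_across_hyperplane {N : StrongDual ℝ V} {P : Set V} (hP : Convex ℝ P)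
    (hc : IsClosed P) (hne : (interior P).Nonempty) {w n : V} (hn : 0 < N n)
    (hw : w ∉ P ∨ IsRadial N P w) :
    ∀ᶠ η : ℝ in 𝓝[>] 0, ∀ᶠ y in 𝓝 (0 : V),
      ind P (w + y + η • n) - ind P (w + y + η • (-n)) =
        ind ((-N).toExposed P) w - ind (N.toExposed P) w := by
  have hn' : 0 < (-N) (-n) := by simpa using hn
  -- an interior point of `P` lies on neither of the two faces
  have hint : ∀ {M : StrongDual ℝ V} {m : V}, 0 < M m → ∀ x ∈ interior P, x ∉ M.toExposed P := by
    intro M m hm x hx hxM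
    obtain ⟨t, h1, h2⟩ := ((eventually_mem_of_mem_open isOpen_interior hx m).and
      (eventually_notMem_of_mem_toExposed hc hm hxM)).exists
    exact interior_subset h2 (interior_subset h1)
  -- a point of the face where `M` is maximal does not lie on the opposite face
  have hopp : ∀ {M : StrongDual ℝ V} {m : V}, 0 < M m → ∀ x, x ∈ M.toExposed P →
      x ∉ (-M).toExposed P := by
    intro M m hm x h1 h2
    obtain ⟨p, hp⟩ := hne
    have hp1 : p ∈ M.toExposed P := by
      refine ⟨interior_subset hp, fun y hy => ?_⟩
      have := h1.2 y hy
      have := h2.2 p (interior_subset hp)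
      simp only [neg_apply, neg_le_neg_iff] at this
      linarith
    exact hint hm p hp hp1
  by_cases hwP : w ∈ P
  · have hw := hw.resolve_left (not_not.2 hwP)
    rcases hw.trichotomy hP hne with h | h | h
    · rw [ind_of_notMem (hint hn w h), ind_of_notMem (hint hn' w h)]
      have h' : w ∈ interior (interior P) := by rwa [interior_interior]
      filter_upwards [eventually_eventually_mem (eventually_mem_of_mem_open isOpen_interior h n),
        eventually_eventually_mem (eventually_mem_of_mem_open isOpen_interior h (-n))]
        with η h1 h2
      filter_upwards [h1, h2] with y h1 h2
      rw [ind_of_mem h1, ind_of_mem h2]; rfl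
    · rw [ind_of_mem h, ind_of_notMem (hopp hn w h)]
      filter_upwards [eventually_eventually_mem
          (eventually_mem_interior_of_isRadial hP hne hn hw h),
        eventually_eventually_mem (eventually_notMem_of_mem_toExposed hc hn h)] with η h1 h2
      filter_upwards [h1, h2] with y h1 h2
      rw [ind_of_mem h1, ind_of_notMem h2]
    · rw [ind_of_mem h, ind_of_notMem (by simpa using hopp hn' w h)]
      have := eventually_mem_interior_of_isRadial hP hne hn' hw.neg h
      rw [neg_neg] at this
      filter_upwards [eventually_eventually_mem this,
        eventually_eventually_mem (eventually_notMem_of_mem_toExposed hc hn' h)] with η h1 h2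
      filter_upwards [h1, h2] with y h1 h2
      rw [ind_of_mem h1, ind_of_notMem h2]
  · rw [ind_of_notMem (fun h => hwP h.1), ind_of_notMem (fun h => hwP h.1)]
    have hint : ∀ m : V, ∀ᶠ η : ℝ in 𝓝[>] 0, w + η • m ∈ interior Pᶜ := by
      rw [hc.isOpen_compl.interior_eq]
      exact eventually_mem_of_mem_open hc.isOpen_compl hwP
    filter_upwards [eventually_eventually_mem (hint n), eventually_eventually_mem (hint (-n))]
      with η h1 h2
    filter_upwards [h1, h2] with y h1 h2
    rw [ind_of_notMem h1, ind_of_notMem h2]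

end LocalGeometry

/-! ### Convex sets near a point of a line -/

section SliceGeometry

open Filter Topology Set

variable {V : Type*} [NormedAddCommGroup V] [NormedSpace ℝ V]

lemma IsRadial.of_add {N : StrongDual ℝ V} {P : Set V} (hP : Convex ℝ P) {z u : V}
    (hu : IsRadial N P (z + u)) (hz : ∀ᶠ t : ℝ in 𝓝 0, z + t • u ∈ P) : IsRadial N P z := by
  have h1 : ∀ᶠ t : ℝ in 𝓝 0, z + (-t) • u ∈ P := by
    have : Tendsto (fun t : ℝ => -t) (𝓝 0) (𝓝 0) := by simpa using (tendsto_id (x := 𝓝 (0:ℝ))).neg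
    exact this.eventually hz
  obtain ⟨t, ht, htpos⟩ :=
    ((h1.filter_mono (nhdsWithin_le_nhds (s := Ioi 0))).and self_mem_nhdsWithin).exists
  have htpos : 0 < t := htpos
  have := hu.combo hP ht (a := t / (1 + t)) (b := 1 / (1 + t)) (by positivity) (by positivity)
    (by field_simp; ring)
  convert this using 1
  have h1t : (1 + t) ≠ 0 := by positivity
  rw [← smul_right_injective V h1t |>.eq_iff]
  simp only [smul_add, smul_smul]
  field_simp
  module

/-- The points of the slice of `P` at the height of `z` where `φ` is minimal on that slice. -/
def sliceMin (N φ : StrongDual ℝ V) (P : Set V) (z : V) : Set V :=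
  {w ∈ P | ∀ q ∈ P, N q = N z → φ w ≤ φ q}

/-- The points of the slice of `P` at the height of `z` where `φ` is maximal on that slice. -/
def sliceMax (N φ : StrongDual ℝ V) (P : Set V) (z : V) : Set V :=
  {w ∈ P | ∀ q ∈ P, N q = N z → φ q ≤ φ w}

lemma sliceMin_neg (N φ : StrongDual ℝ V) (P : Set V) (z : V) :
    sliceMin N (-φ) P z = sliceMax N φ P z := by
  simp [sliceMin, sliceMax]

lemma sliceMax_neg (N φ : StrongDual ℝ V) (P : Set V) (z : V) :
    sliceMax N (-φ) P z = sliceMin N φ P z := by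
  simp [sliceMin, sliceMax]

/-- The jump of the indicator function of a slice of `P` across the line `z + ℝ e`, when the line
misses the relative interior of the slice, which lies on the side of `f`. -/
lemma slice_jump_of_pos {N φ : StrongDual ℝ V} {P : Set V} (hP : Convex ℝ P)
    {e f z : V} (hNe : N e = 0) (hNf : N f = 0) (hφe : φ e = 0) (hφf : 0 < φ f)
    (hspan : ∀ u, N u = 0 → ∃ α β : ℝ, u = α • e + β • f)
    (hz : ∀ᶠ t : ℝ in 𝓝 0, z + t • e ∈ P) (hzr : ¬ IsRadial N P z)
    {α β : ℝ} (hβ : 0 < β) (hp : IsRadial N P (z + α • e + β • f)) :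
    ∀ᶠ δ : ℝ in 𝓝[>] 0, (z + δ • f ∉ P ∨ IsRadial N P (z + δ • f)) ∧
      (z - δ • f ∉ P ∨ IsRadial N P (z - δ • f)) ∧
      ind P (z + δ • f) - ind P (z - δ • f) =
        ind (sliceMin N φ P z) z - ind (sliceMax N φ P z) z := by
  have hzP : z ∈ P := by simpa using hz.self_of_nhds
  -- a radial point on the line through `z` would make `z` radial
  have hline : ∀ γ : ℝ, ¬ IsRadial N P (z + γ • e) := by
    intro γ h
    refine hzr (h.of_add hP ?_)
    have : Tendsto (fun t : ℝ => t * γ) (𝓝 0) (𝓝 0) := by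
      simpa using (tendsto_id (x := 𝓝 (0:ℝ))).mul_const γ
    simpa [mul_smul] using this.eventually hz
  -- hence no point of the slice lies on the other side of the line
  have hside : ∀ γ δ : ℝ, 0 < δ → z + γ • e - δ • f ∉ P := by
    intro γ δ hδ h
    have := hp.combo hP h (a := δ / (δ + β)) (b := β / (δ + β)) (by positivity) (by positivity)
      (by field_simp)
    refine hline (δ / (δ + β) * α + β / (δ + β) * γ) ?_
    convert this using 1
    have h1t : (δ + β) ≠ 0 := by positivity
    rw [← smul_right_injective V h1t |>.eq_iff]
    simp only [smul_add, smul_smul, smul_sub]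
    field_simp
    module
  have hmin : z ∈ sliceMin N φ P z := by
    refine ⟨hzP, fun q hq hqN => ?_⟩
    obtain ⟨γ, δ, h⟩ := hspan (q - z) (by simp [hqN])
    have hq' : q = z + γ • e - (-δ) • f := by
      rw [eq_add_of_sub_eq h]; module
    have hδ : 0 ≤ δ := by
      by_contra! hlt
      exact hside γ (-δ) (by linarith) (hq' ▸ hq)
    rw [eq_add_of_sub_eq h]
    simp only [map_add, map_smul, smul_eq_mul, hφe]
    nlinarith [mul_nonneg hδ hφf.le]
  have hmax : z ∉ sliceMax N φ P z := by
    intro h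
    have := h.2 _ hp.mem (by simp [hNe, hNf])
    simp only [map_add, map_smul, smul_eq_mul, hφe] at this
    nlinarith [mul_pos hβ hφf]
  rw [ind_of_mem hmin, ind_of_notMem hmax]
  have ht : Tendsto (fun δ : ℝ => -((δ / β) * α / (1 - δ / β))) (𝓝[>] 0) (𝓝 0) := by
    have : ContinuousAt (fun δ : ℝ => -((δ / β) * α / (1 - δ / β))) 0 := by
      refine ContinuousAt.neg (ContinuousAt.div ?_ ?_ (by simp)) <;> fun_prop
    have h2 := this.tendsto
    simp only [zero_div, neg_zero, zero_mul] at h2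
    exact h2.mono_left nhdsWithin_le_nhds
  filter_upwards [self_mem_nhdsWithin, Ioo_mem_nhdsGT hβ, ht.eventually hz] with δ hδ hδβ htz
  have hδ : 0 < δ := hδ
  have hminus : z - δ • f ∉ P := by simpa using hside 0 δ hδ
  have h0 : 0 < δ / β := div_pos hδ hβ
  have h1 : δ / β < 1 := (div_lt_one hβ).2 hδβ.2
  have hplus : IsRadial N P (z + δ • f) := by
    have := hp.combo hP htz (a := δ / β) (b := 1 - δ / β) h0 (by linarith) (by ring)
    convert this using 1
    have e1 : (1 - δ / β) ≠ 0 := by linarith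
    have e2 : (1 - δ / β) * (-((δ / β) * α / (1 - δ / β))) = -((δ / β) * α) := by
      rw [mul_neg, mul_div_cancel₀ _ e1]
    have e3 : (δ / β) • (β • f) = δ • f := by rw [smul_smul]; congr 1; field_simp
    rw [smul_add (1 - δ / β), smul_smul, e2, smul_add, smul_add, e3]
    module
  exact ⟨Or.inr hplus, Or.inl hminus, by rw [ind_of_mem hplus.mem, ind_of_notMem hminus]⟩

/-- The jump of the indicator function of a slice of `P` across the line `z + ℝ e`, at a point `z`
which is not an end point of the part of the line in `P`. -/
lemma slice_jump {N φ : StrongDual ℝ V} {P : Set V} (hP : Convex ℝ P) (hc : IsClosed P)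
    {e f z : V} (hNe : N e = 0) (hNf : N f = 0) (hφe : φ e = 0) (hφf : 0 < φ f)
    (hspan : ∀ u, N u = 0 → ∃ α β : ℝ, u = α • e + β • f)
    (hz : z ∉ P ∨ ∀ᶠ t : ℝ in 𝓝 0, z + t • e ∈ P)
    (hp : ∃ p, IsRadial N P p ∧ N p = N z) :
    ∀ᶠ δ : ℝ in 𝓝[>] 0, (z + δ • f ∉ P ∨ IsRadial N P (z + δ • f)) ∧
      (z - δ • f ∉ P ∨ IsRadial N P (z - δ • f)) ∧
      ind P (z + δ • f) - ind P (z - δ • f) =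
        ind (sliceMin N φ P z) z - ind (sliceMax N φ P z) z := by
  by_cases hzP : z ∈ P
  swap
  · filter_upwards [eventually_mem_of_mem_open hc.isOpen_compl hzP f,
      eventually_mem_of_mem_open hc.isOpen_compl hzP (-f)] with δ h1 h2
    rw [smul_neg, ← sub_eq_add_neg] at h2
    refine ⟨Or.inl h1, Or.inl h2, ?_⟩
    rw [ind_of_notMem h1, ind_of_notMem h2, ind_of_notMem (fun h => hzP h.1),
      ind_of_notMem (fun h => hzP h.1)]
  have hz := hz.resolve_left (not_not.2 hzP)
  by_cases hzr : IsRadial N P z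
  · have hboth : ∀ g : V, N g = 0 → ∀ᶠ δ : ℝ in 𝓝[>] 0, IsRadial N P (z + δ • g) := by
      intro g hg
      have h2 := hzr ((2 : ℝ) • g) (by simp [hg])
      filter_upwards [h2.filter_mono nhdsWithin_le_nhds] with δ hδ
      have := hzr.combo hP hδ (a := 1 / 2) (b := 1 / 2) (by norm_num) (by norm_num) (by norm_num)
      convert this using 1
      module
    have hf := hboth f hNf
    have hf' := hboth (-f) (by simp [hNf])
    obtain ⟨δ, ⟨h1, h2⟩, hδ⟩ := ((hf.and hf').and self_mem_nhdsWithin).exists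
    have hδ : 0 < δ := hδ
    have hmin : z ∉ sliceMin N φ P z := by
      intro h
      have := h.2 _ h2.mem (by simp [hNf])
      simp only [map_add, map_smul, smul_eq_mul, map_neg] at this
      nlinarith [mul_pos hδ hφf]
    have hmax : z ∉ sliceMax N φ P z := by
      intro h
      have := h.2 _ h1.mem (by simp [hNf])
      simp only [map_add, map_smul, smul_eq_mul] at this
      nlinarith [mul_pos hδ hφf]
    rw [ind_of_notMem hmin, ind_of_notMem hmax]
    filter_upwards [hf, hf'] with δ h1 h2
    rw [smul_neg, ← sub_eq_add_neg] at h2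
    exact ⟨Or.inr h1, Or.inr h2, by rw [ind_of_mem h1.mem, ind_of_mem h2.mem]; rfl⟩
  obtain ⟨p, hp, hpz⟩ := hp
  obtain ⟨α, β, h⟩ := hspan (p - z) (by simp [hpz])
  have hp' : p = z + α • e + β • f := by
    rw [eq_add_of_sub_eq h]; module
  rw [hp'] at hp
  rcases lt_trichotomy β 0 with hβ | rfl | hβ
  · have := slice_jump_of_pos (φ := -φ) (f := -f) (β := -β) hP hNe (by simpa using hNf)
      (by simpa using hφe) (by simpa using hφf) (fun u hu => by
        obtain ⟨a, b, h⟩ := hspan u hu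
        exact ⟨a, -b, by rw [h]; module⟩) hz hzr (by linarith) (by simpa using hp)
    filter_upwards [this] with δ hδ
    simp only [smul_neg, sub_neg_eq_add, ← sub_eq_add_neg, sliceMin_neg, sliceMax_neg] at hδ
    exact ⟨hδ.2.1, hδ.1, by linarith [hδ.2.2]⟩
  · exfalso
    refine hzr (IsRadial.of_add (u := α • e) hP (by simpa using hp) ?_)
    have : Tendsto (fun t : ℝ => t * α) (𝓝 0) (𝓝 0) := by
      simpa using (tendsto_id (x := 𝓝 (0:ℝ))).mul_const α
    simpa [mul_smul] using this.eventually hz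
  · exact slice_jump_of_pos hP hNe hNf hφe hφf hspan hz hzr hβ hp

/-- On each level of `N`, the face of `P` where `N` is maximal is either everything or nothing. -/
lemma exists_ind_toExposed_eq_mul (N φ : StrongDual ℝ V) (P : Set V) (z : V) :
    ∃ κ : ℤ, (∀ w, N w = N z → ind (N.toExposed P) w = κ * ind P w) ∧
      ind ((-φ).toExposed (N.toExposed P)) z = κ * ind (sliceMin N φ P z) z ∧
      ind (φ.toExposed (N.toExposed P)) z = κ * ind (sliceMax N φ P z) z := by
  by_cases h : ∃ w ∈ N.toExposed P, N w = N z
  · obtain ⟨w₀, hw₀, hwz⟩ := h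
    have key : ∀ w, N w = N z → (w ∈ N.toExposed P ↔ w ∈ P) := fun w hw =>
      ⟨fun h => h.1, fun h => ⟨h, fun y hy => by rw [hw, ← hwz]; exact hw₀.2 y hy⟩⟩
    have hlev : ∀ w ∈ N.toExposed P, N w = N z := fun w hw =>
      hwz ▸ le_antisymm (hw₀.2 w hw.1) (hw.2 w₀ hw₀.1)
    refine ⟨1, fun w hw => ?_, ?_, ?_⟩
    · rw [one_mul]; exact ind_congr (key w hw)
    · have : z ∈ (-φ).toExposed (N.toExposed P) ↔ z ∈ sliceMin N φ P z := by
        constructor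
        · rintro ⟨h1, h2⟩
          exact ⟨h1.1, fun q hq hqz => by simpa using h2 q ((key q hqz).2 hq)⟩
        · rintro ⟨h1, h2⟩
          exact ⟨(key z rfl).2 h1, fun q hq => by simpa using h2 q hq.1 (hlev q hq)⟩
      rw [one_mul]; exact ind_congr this
    · have : z ∈ φ.toExposed (N.toExposed P) ↔ z ∈ sliceMax N φ P z := by
        constructor
        · rintro ⟨h1, h2⟩
          exact ⟨h1.1, fun q hq hqz => h2 q ((key q hqz).2 hq)⟩
        · rintro ⟨h1, h2⟩
          exact ⟨(key z rfl).2 h1, fun q hq => h2 q hq.1 (hlev q hq)⟩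
      rw [one_mul]; exact ind_congr this
  · push Not at h
    refine ⟨0, fun w hw => ?_, ?_, ?_⟩
    · rw [ind_of_notMem (fun hw' => h w hw' hw), zero_mul]
    · rw [ind_of_notMem (fun hw' => h z hw'.1 rfl), zero_mul]
    · rw [ind_of_notMem (fun hw' => h z hw'.1 rfl), zero_mul]

/-- The alternating sum of the indicator function of `P` over the four points `z ± δ f ± η n`. -/
noncomputable def altSum (P : Set V) (f n : V) (δ η : ℝ) (z : V) : ℤ :=
  ind P (z + δ • f + η • n) - ind P (z + δ • f - η • n)
    - ind P (z - δ • f + η • n) + ind P (z - δ • f - η • n)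

/-- At a point `z` which is not an end point of `P ∩ (z + ℝ e)`, the alternating sum of the
indicator function of `P` over four points around `z + ℝ e` sees only the four edges
parallel to `e` of the two faces of `P` where `N` is extremal. The perturbation `y` is there because
a tiling covers only almost every point exactly `k` times. -/
theorem eventually_altSum_eq {N φ : StrongDual ℝ V} {P : Set V} (hP : Convex ℝ P)
    (hc : IsClosed P) (hne : (interior P).Nonempty)
    {e f n z : V} (hNe : N e = 0) (hNf : N f = 0) (hNn : 0 < N n) (hφe : φ e = 0) (hφf : 0 < φ f)
    (hspan : ∀ u, N u = 0 → ∃ α β : ℝ, u = α • e + β • f)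
    (hmax : ∃ p ∈ N.toExposed P, IsRadial N P p) (hmin : ∃ p ∈ (-N).toExposed P, IsRadial N P p)
    (hz : z ∉ P ∨ ∀ᶠ t : ℝ in 𝓝 0, z + t • e ∈ P) :
    ∀ᶠ δ : ℝ in 𝓝[>] 0, ∀ᶠ η : ℝ in 𝓝[>] 0, ∀ᶠ y in 𝓝 (0 : V),
      altSum P f n δ η (z + y) =
        - ind ((-φ).toExposed (N.toExposed P)) z + ind (φ.toExposed (N.toExposed P)) z
        + ind ((-φ).toExposed ((-N).toExposed P)) z - ind (φ.toExposed ((-N).toExposed P)) z := by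
  have hslice : ∀ᶠ δ : ℝ in 𝓝[>] 0, (z + δ • f ∉ P ∨ IsRadial N P (z + δ • f)) ∧
      (z - δ • f ∉ P ∨ IsRadial N P (z - δ • f)) ∧
      ind P (z + δ • f) - ind P (z - δ • f) =
        ind (sliceMin N φ P z) z - ind (sliceMax N φ P z) z := by
    by_cases hp : ∃ p, IsRadial N P p ∧ N p = N z
    · exact slice_jump hP hc hNe hNf hφe hφf hspan hz hp
    -- without a radial point the slice is empty
    have hempty : ∀ w, N w = N z → w ∉ P := by
      intro w hw hwP
      rcases mem_toExposed_or_of_forall_ne hP hne hwP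
        (fun p hp1 hp2 => hp ⟨p, isRadial_of_mem_interior N hp1, hp2.trans hw⟩) with h | h
      · obtain ⟨p, hpF, hpr⟩ := hmax
        exact hp ⟨p, hpr, hw ▸ le_antisymm (h.2 p hpF.1) (hpF.2 w hwP)⟩
      · obtain ⟨p, hpF, hpr⟩ := hmin
        have h1 := h.2 p hpF.1
        have h2 := hpF.2 w hwP
        simp only [neg_apply, neg_le_neg_iff] at h1 h2
        exact hp ⟨p, hpr, hw ▸ le_antisymm h2 h1⟩
    refine Eventually.of_forall fun δ => ?_
    have h1 := hempty (z + δ • f) (by simp [hNf])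
    have h2 := hempty (z - δ • f) (by simp [hNf])
    have h3 := hempty z rfl
    refine ⟨Or.inl h1, Or.inl h2, ?_⟩
    rw [ind_of_notMem h1, ind_of_notMem h2, ind_of_notMem (fun h => h3 h.1),
      ind_of_notMem (fun h => h3 h.1)]
  obtain ⟨κ, hκ, hκ1, hκ2⟩ := exists_ind_toExposed_eq_mul N φ P z
  obtain ⟨κ', hκ', hκ1', hκ2'⟩ := exists_ind_toExposed_eq_mul (-N) φ P z
  have hsl : sliceMin (-N) φ P z = sliceMin N φ P z := by simp [sliceMin]
  have hsl' : sliceMax (-N) φ P z = sliceMax N φ P z := by simp [sliceMax]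
  rw [hκ1, hκ2, hκ1', hκ2', hsl, hsl']
  filter_upwards [hslice] with δ hδ
  filter_upwards [jump_across_hyperplane hP hc hne hNn hδ.1,
    jump_across_hyperplane hP hc hne hNn hδ.2.1] with η h1 h2
  filter_upwards [h1, h2] with y h1 h2
  rw [hκ _ (by simp [hNf]), hκ' _ (by simp [hNf])] at h1 h2
  have e1 : z + δ • f + y = z + y + δ • f := by abel
  have e2 : z - δ • f + y = z + y - δ • f := by abel
  rw [e1, smul_neg, ← sub_eq_add_neg] at h1
  rw [e2, smul_neg, ← sub_eq_add_neg] at h2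
  unfold altSum
  linear_combination h1 - h2 + (κ' - κ) * hδ.2.2

end SliceGeometry

/-! ### Multisets of translations of a multiple tiling -/

section TilingMultiset

open Filter Topology Set

variable {P : Set E3} {Λ : E3 → ℕ} {k : ℕ}

lemma ennreal_indicator_vadd (S : Set E3) (v x : E3) :
    (v +ᵥ S).indicator (fun _ => (1 : ℝ≥0∞)) x = S.indicator (fun _ => (1 : ℝ≥0∞)) (x - v) := by
  have : x ∈ v +ᵥ S ↔ x - v ∈ S := by
    rw [Set.mem_vadd_set_iff_neg_vadd_mem, vadd_eq_add, neg_add_eq_sub]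
  by_cases h : x ∈ v +ᵥ S
  · rw [indicator_of_mem h, indicator_of_mem (this.1 h)]
  · rw [indicator_of_notMem h, indicator_of_notMem (fun h' => h (this.2 h'))]

/-- A small ball contains at most `k` translation vectors of a tiling at level `k`. -/
lemma TilesAtLevel.exists_local_bound (htile : TilesAtLevel P Λ k) (hne : (interior P).Nonempty) :
    ∃ r > 0, ∀ x : E3, ∀ T : Finset E3, (∀ v ∈ T, v ∈ Metric.ball x r) → ∑ v ∈ T, Λ v ≤ k := by
  obtain ⟨p, hp⟩ := hne
  obtain ⟨r, hr, hball⟩ := Metric.isOpen_iff.1 isOpen_interior p hp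
  refine ⟨r / 2, by positivity, fun x T hT => ?_⟩
  obtain ⟨y, hy, hyk⟩ := (Measure.dense_of_ae htile).inter_open_nonempty
    (Metric.ball (x + p) (r / 2)) Metric.isOpen_ball ⟨x + p, Metric.mem_ball_self (by positivity)⟩
  have hyk : ∑' v : E3, (Λ v : ℝ≥0∞) * (v +ᵥ P).indicator (fun _ => (1 : ℝ≥0∞)) y = k := hyk
  have h1 : ∑ v ∈ T, (Λ v : ℝ≥0∞) ≤ (k : ℝ≥0∞) := by
    rw [← hyk]
    refine le_trans (Finset.sum_le_sum fun v hv => ?_) (ENNReal.sum_le_tsum T)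
    rw [ennreal_indicator_vadd, indicator_of_mem, mul_one]
    refine interior_subset (hball ?_)
    have h1 := hT v hv
    rw [Metric.mem_ball, dist_eq_norm] at h1 hy ⊢
    calc ‖y - v - p‖ = ‖(y - (x + p)) - (v - x)‖ := by congr 1; abel
      _ ≤ ‖y - (x + p)‖ + ‖v - x‖ := norm_sub_le _ _
      _ < r := by linarith
  exact_mod_cast h1

lemma TilesAtLevel.finite_support_inter_ball (htile : TilesAtLevel P Λ k)
    (hne : (interior P).Nonempty) (x : E3) (R : ℝ) :
    (Metric.closedBall x R ∩ Function.support Λ).Finite := by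
  obtain ⟨r, hr, h⟩ := htile.exists_local_bound hne
  refine (isCompact_closedBall x R).induction_on (p := fun s => (s ∩ Function.support Λ).Finite)
    (by simp) (fun s t hst ht => ht.subset (inter_subset_inter_left _ hst))
    (fun s t hs ht => by rw [union_inter_distrib_right]; exact hs.union ht)
    (fun x _ => ⟨Metric.ball x r, mem_nhdsWithin_of_mem_nhds (Metric.ball_mem_nhds x hr), ?_⟩)
  by_contra hinf
  obtain ⟨T, hT, hcard⟩ := Set.Infinite.exists_subset_card_eq hinf (k + 1)
  have h1 := h x T (fun v hv => (hT hv).1)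
  have h2 : T.card ≤ ∑ v ∈ T, Λ v := by
    rw [Finset.card_eq_sum_ones]
    exact Finset.sum_le_sum fun v hv => Nat.one_le_iff_ne_zero.2 (hT hv).2
  omega

lemma TilesAtLevel.countable_support (htile : TilesAtLevel P Λ k) (hne : (interior P).Nonempty) :
    (Function.support Λ).Countable := by
  have : Function.support Λ = ⋃ n : ℕ, Metric.closedBall 0 n ∩ Function.support Λ := by
    rw [← iUnion_inter, Metric.iUnion_closedBall_nat, univ_inter]
  rw [this]
  exact countable_iUnion fun n => (htile.finite_support_inter_ball hne 0 n).countable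

/-- The measure `δ_Λ` as a sum over the support of `Λ`. -/
lemma deltaMeasure_eq_sum_support (Λ : E3 → ℕ) :
    deltaMeasure Λ =
      Measure.sum fun v : Function.support Λ => (Λ v : ℝ≥0∞) • Measure.dirac (v : E3) := by
  ext s hs
  rw [deltaMeasure, Measure.sum_apply _ hs, Measure.sum_apply _ hs]
  refine (tsum_subtype_eq_of_support_subset (s := Function.support Λ)
    (f := fun v => ((Λ v : ℝ≥0∞) • Measure.dirac v) s) ?_).symm
  intro v hv hv'
  exact hv (by simp [show Λ v = 0 by simpa using hv'])

lemma tsum_support_mul (Λ : E3 → ℕ) (g : E3 → ℝ≥0∞) :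
    ∑' v : Function.support Λ, (Λ v : ℝ≥0∞) * g v = ∑' v, (Λ v : ℝ≥0∞) * g v := by
  refine tsum_subtype_eq_of_support_subset (s := Function.support Λ)
    (f := fun v => (Λ v : ℝ≥0∞) * g v) ?_
  intro v hv hv'
  exact hv (by simp [show Λ v = 0 by simpa using hv'])

lemma lintegral_deltaMeasure (Λ : E3 → ℕ) {g : E3 → ℝ≥0∞} (hg : Measurable g) :
    ∫⁻ v, g v ∂deltaMeasure Λ = ∑' v : Function.support Λ, (Λ v : ℝ≥0∞) * g v := by
  rw [deltaMeasure_eq_sum_support, lintegral_sum_measure]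
  simp_rw [lintegral_smul_measure, lintegral_dirac' _ hg, smul_eq_mul]

/-- If `P` is bounded with interior points, then the value of `(1 + ‖x‖)⁻⁴` at a translation
vector `v` is controlled by its integral over `v + P`; by the tiling property, these integrals sum
up to a finite number. -/
theorem TilesAtLevel.hasTemperateGrowth (htile : TilesAtLevel P Λ k) (hc : IsCompact P)
    (hne : (interior P).Nonempty) : (deltaMeasure Λ).HasTemperateGrowth := by
  refine ⟨4, Measurable.aestronglyMeasurable (by fun_prop), ?_⟩
  have := (htile.countable_support hne).to_subtype
  obtain ⟨R, hR0, hR⟩ := hc.isBounded.subset_closedBall_lt 0 0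
  set F : E3 → ℝ≥0∞ := fun x => ENNReal.ofReal ((1 + ‖x‖) ^ (-((4 : ℕ) : ℝ))) with hF
  have hFm : Measurable F := by fun_prop
  have hPm : MeasurableSet P := hc.isClosed.measurableSet
  have hvol : 0 < volume P := Measure.measure_pos_of_nonempty_interior _ hne
  have hvol' : volume P < ∞ := hc.measure_lt_top
  set C : ℝ≥0∞ := ENNReal.ofReal ((1 + R) ^ ((4 : ℕ) : ℝ)) with hC
  have hvP : ∀ v : E3, MeasurableSet (v +ᵥ P) := fun v => hPm.const_vadd v
  have hcomp : ∀ v : E3, F v * volume P ≤ C * ∫⁻ y in (v +ᵥ P), F y := by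
    intro v
    rw [← lintegral_const_mul _ hFm, mul_comm]
    have : volume P = volume (v +ᵥ P) := (measure_vadd volume v P).symm
    rw [this, mul_comm, ← setLIntegral_const]
    refine setLIntegral_mono (by fun_prop) fun y hy => ?_
    obtain ⟨p, hp, rfl⟩ := hy
    have hp' : ‖p‖ ≤ R := by simpa using hR hp
    rw [hC, hF, ← ENNReal.ofReal_mul (by positivity)]
    refine ENNReal.ofReal_le_ofReal ?_
    simp only [vadd_eq_add]
    have h1 : 1 + ‖v + p‖ ≤ (1 + R) * (1 + ‖v‖) := by
      nlinarith [norm_add_le v p, norm_nonneg v, norm_nonneg p]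
    rw [Real.rpow_neg (by positivity), Real.rpow_neg (by positivity)]
    rw [← div_eq_mul_inv, le_div_iff₀ (by positivity), inv_mul_le_iff₀ (by positivity),
      ← Real.mul_rpow (by positivity) (by positivity)]
    refine Real.rpow_le_rpow (by positivity) (by linarith) (by positivity)
  have hfin : ∫⁻ y, F y < ∞ := by
    refine finite_integral_one_add_norm (μ := (volume : Measure E3)) ?_
    simp
    norm_num
  have hsum : (∑' v : Function.support Λ, (Λ v : ℝ≥0∞) * F v) * volume P ≤
      C * (k * ∫⁻ y, F y) := by
    calc (∑' v : Function.support Λ, (Λ v : ℝ≥0∞) * F v) * volume P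
        = ∑' v : Function.support Λ, (Λ v : ℝ≥0∞) * (F v * volume P) := by
          rw [← ENNReal.tsum_mul_right]; simp_rw [mul_assoc]
      _ ≤ ∑' v : Function.support Λ, (Λ v : ℝ≥0∞) * (C * ∫⁻ y in ((v : E3) +ᵥ P), F y) := by
          exact ENNReal.tsum_le_tsum fun v => mul_le_mul' le_rfl (hcomp v)
      _ = C * ∑' v : Function.support Λ, ∫⁻ y,
            (Λ v : ℝ≥0∞) * ((v : E3) +ᵥ P).indicator (fun _ => (1 : ℝ≥0∞)) y * F y := by
          rw [← ENNReal.tsum_mul_left]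
          refine tsum_congr fun v => ?_
          rw [mul_left_comm, ← lintegral_indicator (hvP v), ← lintegral_const_mul]
          · congr 1
            refine lintegral_congr fun y => ?_
            by_cases h : y ∈ ((v : E3) +ᵥ P) <;> simp [h]
          · exact hFm.indicator (hvP v)
      _ = C * ∫⁻ y, (∑' v : Function.support Λ,
            (Λ v : ℝ≥0∞) * ((v : E3) +ᵥ P).indicator (fun _ => (1 : ℝ≥0∞)) y) * F y := by
          rw [← lintegral_tsum]
          · simp_rw [ENNReal.tsum_mul_right]
          · intro v
            exact (((measurable_const.indicator (hvP v)).const_mul _).mul hFm).aemeasurable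
      _ = C * (k * ∫⁻ y, F y) := by
          rw [← lintegral_const_mul _ hFm]
          congr 1
          refine lintegral_congr_ae ?_
          filter_upwards [htile] with y hy
          rw [← hy, tsum_support_mul Λ
            (fun v => (v +ᵥ P).indicator (fun _ => (1 : ℝ≥0∞)) y)]
  have hlt : ∫⁻ v, F v ∂deltaMeasure Λ < ∞ := by
    rw [lintegral_deltaMeasure Λ hFm]
    by_contra htop
    rw [not_lt, top_le_iff] at htop
    rw [htop, ENNReal.top_mul hvol.ne', top_le_iff] at hsum
    exact ENNReal.mul_ne_top ENNReal.ofReal_ne_top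
      (ENNReal.mul_ne_top (by simp) hfin.ne) hsum
  refine lt_of_le_of_lt (le_of_eq (lintegral_congr fun v => ?_)) hlt
  rw [hF, Real.enorm_eq_ofReal (by positivity)]

lemma TilesAtLevel.sFinite_deltaMeasure (htile : TilesAtLevel P Λ k)
    (hne : (interior P).Nonempty) : SFinite (deltaMeasure Λ) := by
  have := (htile.countable_support hne).to_subtype
  rw [deltaMeasure_eq_sum_support]
  infer_instance

/-- The number of translates of `P` covering `c`, as a finite sum of integers. -/
lemma sum_ind_eq_of_tsum_eq {c : E3} {A : Finset E3}
    (hA : ∀ v ∉ A, Λ v = 0 ∨ c - v ∉ P)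
    (h : ∑' v : E3, (Λ v : ℝ≥0∞) * (v +ᵥ P).indicator (fun _ => (1 : ℝ≥0∞)) c = k) :
    ∑ v ∈ A, (Λ v : ℤ) * ind P (c - v) = k := by
  classical
  rw [tsum_eq_sum (s := A)] at h
  · have h2 : ∑ v ∈ A, Λ v * (if c - v ∈ P then 1 else 0) = k := by
      have : ((∑ v ∈ A, Λ v * (if c - v ∈ P then 1 else 0) : ℕ) : ℝ≥0∞) = (k : ℕ) := by
        rw [← h]
        push_cast
        refine Finset.sum_congr rfl fun v _ => ?_
        rw [ennreal_indicator_vadd]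
        by_cases hv : c - v ∈ P <;> simp [hv]
      exact_mod_cast this
    rw [← h2]
    push_cast
    refine Finset.sum_congr rfl fun v _ => ?_
    by_cases hv : c - v ∈ P <;> simp [hv, ind]
  · intro v hv
    rw [ennreal_indicator_vadd]
    rcases hA v hv with h | h <;> simp [h]

end TilingMultiset

/-! ### Cancellation of edges -/

section EdgeCancellation

open Filter Topology Set

variable {P : Set E3} {Λ : E3 → ℕ} {k : ℕ}

/-- The data by which two functionals `N` and `φ` single out four parallel edges of `P`: the edges
have direction `e`, the vector `f` completes `e` to a basis of the kernel of `N`, and the faces of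
`P` where `N` is extremal have interior points relative to that kernel. -/
structure EdgeData (P : Set E3) (N φ : StrongDual ℝ E3) (e f n : E3) : Prop where
  N_e : N e = 0
  N_f : N f = 0
  N_n : 0 < N n
  φ_e : φ e = 0
  φ_f : 0 < φ f
  span : ∀ u, N u = 0 → ∃ α β : ℝ, u = α • e + β • f
  max_radial : ∃ p ∈ N.toExposed P, IsRadial N P p
  min_radial : ∃ p ∈ (-N).toExposed P, IsRadial N P p

/-- The number of translates by `Λ` of the set `S` which cover `x`. -/
noncomputable def coverCount (Λ : E3 → ℕ) (S : Set E3) (x : E3) : ℝ≥0∞ :=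
  ∑' v : Function.support Λ,
    (Λ v : ℝ≥0∞) * ((v : E3) +ᵥ S).indicator (fun _ => (1 : ℝ≥0∞)) x

lemma coverCount_eq_sum {S : Set E3} {x : E3} {A : Finset E3}
    (hA : ∀ v ∉ A, Λ v = 0 ∨ x - v ∉ S) :
    ∃ m : ℕ, coverCount Λ S x = m ∧ (m : ℤ) = ∑ v ∈ A, (Λ v : ℤ) * ind S (x - v) := by
  classical
  refine ⟨∑ v ∈ A, Λ v * (if x - v ∈ S then 1 else 0), ?_, ?_⟩
  · rw [coverCount, tsum_support_mul Λ (fun v => (v +ᵥ S).indicator (fun _ => (1 : ℝ≥0∞)) x),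
      tsum_eq_sum (s := A)]
    · push_cast
      refine Finset.sum_congr rfl fun v _ => ?_
      rw [ennreal_indicator_vadd]
      by_cases hv : x - v ∈ S <;> simp [hv]
    · intro v hv
      rw [ennreal_indicator_vadd]
      rcases hA v hv with h | h <;> simp [h]
  · push_cast
    refine Finset.sum_congr rfl fun v _ => ?_
    by_cases hv : x - v ∈ S <;> simp [hv, ind]

/-- For a convex set in a finite-dimensional space, almost every point of a line either is outside
the set or has a neighbourhood in the line that lies in the set. -/
lemma ae_line_notMem_or_eventually_mem (hP : Convex ℝ P) (hc : IsClosed P) (b e : E3) :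
    ∀ᵐ s : ℝ, b + s • e ∉ P ∨ ∀ᶠ t : ℝ in 𝓝 0, b + s • e + t • e ∈ P := by
  have hconv : Convex ℝ ((fun s : ℝ => b + s • e) ⁻¹' P) := by
    have : (fun s : ℝ => b + s • e) = AffineMap.lineMap (k := ℝ) b (b + e) := by
      ext s; simp [AffineMap.lineMap_apply]; ring
    rw [this]
    exact hP.affine_preimage _
  have hclosed : IsClosed ((fun s : ℝ => b + s • e) ⁻¹' P) := hc.preimage (by fun_prop)
  have h0 := hconv.addHaar_frontier volume
  filter_upwards [measure_eq_zero_iff_ae_notMem.1 h0] with s hs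
  rw [frontier, Set.mem_sdiff, not_and_not_right, hclosed.closure_eq] at hs
  by_cases h : b + s • e ∈ P
  · right
    have h1 := mem_interior_iff_mem_nhds.1 (hs h)
    have h2 : Tendsto (fun t : ℝ => s + t) (𝓝 0) (𝓝 s) := by
      have : Continuous (fun t : ℝ => s + t) := by fun_prop
      simpa using this.tendsto 0
    filter_upwards [h2.eventually h1] with t ht
    simpa [add_smul, add_assoc] using ht
  · exact Or.inl h

/-- Along almost every point of a line parallel to the edges, the translates of the four edges
singled out by `EdgeData` cancel in a multiple tiling. -/
theorem TilesAtLevel.ae_coverCount_add_eq (htile : TilesAtLevel P Λ k) (hP : Convex ℝ P)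
    (hcpt : IsCompact P) (hne : (interior P).Nonempty) {N φ : StrongDual ℝ E3} {e f n : E3}
    (hd : EdgeData P N φ e f n) (b : E3) :
    ∀ᵐ s : ℝ,
      coverCount Λ ((-φ).toExposed (N.toExposed P)) (b + s • e)
          + coverCount Λ (φ.toExposed ((-N).toExposed P)) (b + s • e) =
        coverCount Λ (φ.toExposed (N.toExposed P)) (b + s • e)
          + coverCount Λ ((-φ).toExposed ((-N).toExposed P)) (b + s • e) := by
  have hgen : ∀ᵐ s : ℝ, ∀ v ∈ Function.support Λ,
      (b - v) + s • e ∉ P ∨ ∀ᶠ t : ℝ in 𝓝 0, (b - v) + s • e + t • e ∈ P :=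
    (ae_ball_iff (htile.countable_support hne)).2 fun v _ =>
      ae_line_notMem_or_eventually_mem hP hcpt.isClosed (b - v) e
  filter_upwards [hgen] with s hs
  set x := b + s • e with hx
  obtain ⟨R, hR⟩ := hcpt.isBounded.subset_closedBall 0
  set A : Finset E3 := (htile.finite_support_inter_ball hne x (R + 1)).toFinset with hAdef
  -- only the translation vectors in `A` matter within distance `1` of `x`
  have hA : ∀ y : E3, ‖y‖ < 1 → ∀ v ∉ A, Λ v = 0 ∨ x + y - v ∉ P := by
    intro y hy v hv
    by_contra! hcon
    refine hv ?_
    rw [hAdef, Finite.mem_toFinset]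
    refine ⟨?_, hcon.1⟩
    have h1 : ‖x + y - v‖ ≤ R := by simpa using hR hcon.2
    rw [Metric.mem_closedBall, dist_comm, dist_eq_norm]
    calc ‖x - v‖ = ‖(x + y - v) - y‖ := by congr 1; abel
      _ ≤ ‖x + y - v‖ + ‖y‖ := norm_sub_le _ _
      _ ≤ R + 1 := by linarith
  have hev : ∀ᶠ δ : ℝ in 𝓝[>] 0, ∀ᶠ η : ℝ in 𝓝[>] 0, ∀ᶠ y in 𝓝 (0 : E3), ∀ v ∈ A,
      altSum P f n δ η (x - v + y) =
        - ind ((-φ).toExposed (N.toExposed P)) (x - v) + ind (φ.toExposed (N.toExposed P)) (x - v)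
        + ind ((-φ).toExposed ((-N).toExposed P)) (x - v)
        - ind (φ.toExposed ((-N).toExposed P)) (x - v) := by
    have : ∀ v ∈ A, ∀ᶠ δ : ℝ in 𝓝[>] 0, ∀ᶠ η : ℝ in 𝓝[>] 0, ∀ᶠ y in 𝓝 (0 : E3),
      altSum P f n δ η (x - v + y) =
        - ind ((-φ).toExposed (N.toExposed P)) (x - v) + ind (φ.toExposed (N.toExposed P)) (x - v)
        + ind ((-φ).toExposed ((-N).toExposed P)) (x - v)
        - ind (φ.toExposed ((-N).toExposed P)) (x - v) := by
      intro v hv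
      rw [hAdef, Finite.mem_toFinset] at hv
      have e1 : x - v = b - v + s • e := by rw [hx]; abel
      rw [e1]
      exact eventually_altSum_eq hP hcpt.isClosed hne hd.N_e hd.N_f hd.N_n hd.φ_e hd.φ_f hd.span
        hd.max_radial hd.min_radial (hs v hv.2)
    filter_upwards [(Filter.eventually_all_finset A).2 this] with δ h
    filter_upwards [(Filter.eventually_all_finset A).2 h] with η h
    exact (Filter.eventually_all_finset A).2 h
  have hsmall : ∀ g : E3, ∀ᶠ δ : ℝ in 𝓝[>] 0, ‖δ • g‖ < 1 / 3 := by
    intro g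
    have : Tendsto (fun δ : ℝ => ‖δ • g‖) (𝓝 0) (𝓝 0) := by
      have : Continuous (fun δ : ℝ => ‖δ • g‖) := by fun_prop
      simpa using this.tendsto 0
    exact (this.eventually (gt_mem_nhds (by norm_num))).filter_mono nhdsWithin_le_nhds
  obtain ⟨δ, hδ, hδf⟩ := (hev.and (hsmall f)).exists
  obtain ⟨η, hη, hηn⟩ := (hδ.and (hsmall n)).exists
  have hy1 : ∀ᶠ y in 𝓝 (0 : E3), ‖y‖ < 1 / 3 := by
    filter_upwards [Metric.ball_mem_nhds (0 : E3) (show (0 : ℝ) < 1 / 3 by norm_num)] with y hy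
    simpa using hy
  have hshift : ∀ c : E3, ∀ᵐ y : E3, ∑' v : E3, (Λ v : ℝ≥0∞) *
      (v +ᵥ P).indicator (fun _ => (1 : ℝ≥0∞)) (c + y) = (k : ℝ≥0∞) := fun c =>
    (measurePreserving_add_left volume c).quasiMeasurePreserving.ae htile
  -- a small shift `y` moves all four points out of the null set where the covering number is not `k`
  obtain ⟨y, ⟨h1, h2, h3, h4⟩, hy, hysmall⟩ := (Measure.dense_of_ae
    ((hshift (x + (δ • f + η • n))).and ((hshift (x + (δ • f - η • n))).and
    ((hshift (x + (-(δ • f) + η • n))).and (hshift (x + (-(δ • f) - η • n))))))).inter_nhds_nonempty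
    (hη.and hy1)
  have hbound : ∀ g h : E3, ‖g‖ < 1 / 3 → ‖h‖ < 1 / 3 → ‖g + h + y‖ < 1 := by
    intro g h hg hh
    calc ‖g + h + y‖ ≤ ‖g‖ + ‖h‖ + ‖y‖ := norm_add₃_le
      _ < 1 := by linarith
  have hcount : ∀ g : E3, ‖g + y‖ < 1 → ∑' v : E3, (Λ v : ℝ≥0∞) *
      (v +ᵥ P).indicator (fun _ => (1 : ℝ≥0∞)) (x + g + y) = (k : ℝ≥0∞) →
      ∑ v ∈ A, (Λ v : ℤ) * ind P (x + (g + y) - v) = k := by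
    intro g hg h
    rw [add_assoc] at h
    exact sum_ind_eq_of_tsum_eq (hA _ hg) h
  have hδf' : ‖-(δ • f)‖ < 1 / 3 := by rwa [norm_neg]
  have hηn' : ‖-(η • n)‖ < 1 / 3 := by rwa [norm_neg]
  have c1 := hcount _ (hbound _ _ hδf hηn) h1
  have c2 := hcount _ (by rw [sub_eq_add_neg]; exact hbound _ _ hδf hηn') h2
  have c3 := hcount _ (hbound _ _ hδf' hηn) h3
  have c4 := hcount _ (by rw [sub_eq_add_neg]; exact hbound _ _ hδf' hηn') h4
  have hzero : ∑ v ∈ A, (Λ v : ℤ) * altSum P f n δ η (x - v + y) = 0 := by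
    have : ∀ v ∈ A, (Λ v : ℤ) * altSum P f n δ η (x - v + y) =
        (Λ v : ℤ) * ind P (x + (δ • f + η • n + y) - v)
        - (Λ v : ℤ) * ind P (x + (δ • f - η • n + y) - v)
        - (Λ v : ℤ) * ind P (x + (-(δ • f) + η • n + y) - v)
        + (Λ v : ℤ) * ind P (x + (-(δ • f) - η • n + y) - v) := by
      intro v _
      have e1 : x - v + y + δ • f + η • n = x + (δ • f + η • n + y) - v := by abel
      have e2 : x - v + y + δ • f - η • n = x + (δ • f - η • n + y) - v := by abel
      have e3 : x - v + y - δ • f + η • n = x + (-(δ • f) + η • n + y) - v := by abel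
      have e4 : x - v + y - δ • f - η • n = x + (-(δ • f) - η • n + y) - v := by abel
      rw [altSum, e1, e2, e3, e4]
      ring
    rw [Finset.sum_congr rfl this, Finset.sum_add_distrib, Finset.sum_sub_distrib,
      Finset.sum_sub_distrib, c1, c2, c3, c4]
    ring
  rw [Finset.sum_congr rfl (fun v hv => by rw [hy v hv])] at hzero
  have hA0 : ∀ S ⊆ P, ∀ v ∉ A, Λ v = 0 ∨ x - v ∉ S := by
    intro S hS v hv
    refine (hA 0 (by simp) v hv).imp_right fun h h' => h ?_
    simpa using hS h'
  have sub : ∀ (M : StrongDual ℝ E3) (S : Set E3), M.toExposed S ⊆ S := fun M S _ h => h.1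
  obtain ⟨m1, a1, b1⟩ := coverCount_eq_sum
    (hA0 ((-φ).toExposed (N.toExposed P)) ((sub _ _).trans (sub _ _)))
  obtain ⟨m2, a2, b2⟩ := coverCount_eq_sum
    (hA0 (φ.toExposed (N.toExposed P)) ((sub _ _).trans (sub _ _)))
  obtain ⟨m3, a3, b3⟩ := coverCount_eq_sum
    (hA0 ((-φ).toExposed ((-N).toExposed P)) ((sub _ _).trans (sub _ _)))
  obtain ⟨m4, a4, b4⟩ := coverCount_eq_sum
    (hA0 (φ.toExposed ((-N).toExposed P)) ((sub _ _).trans (sub _ _)))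
  rw [a1, a2, a3, a4]
  have : (m1 : ℤ) + m4 = m2 + m3 := by
    rw [b1, b2, b3, b4, ← Finset.sum_add_distrib, ← Finset.sum_add_distrib, ← sub_eq_zero,
      ← Finset.sum_sub_distrib, ← neg_eq_zero, ← Finset.sum_neg_distrib, ← hzero]
    refine Finset.sum_congr rfl fun v _ => ?_
    ring
  exact_mod_cast this

end EdgeCancellation

/-! ### The measures carried by the translates of an edge -/

section LegMeasure

open Filter Topology Set

variable {P : Set E3} {Λ : E3 → ℕ} {k : ℕ}

/-- The sum over `v ∈ Λ` of the images of Lebesgue measure on `[0, 1]` under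
`s ↦ v + b + s • e`. -/
noncomputable def legMeasure (Λ : E3 → ℕ) (b e : E3) : Measure E3 :=
  ((deltaMeasure Λ).prod (volume.restrict (Icc (0 : ℝ) 1))).map fun p => p.1 + b + p.2 • e

lemma volume_restrict_preimage_segment {b e : E3} (he : e ≠ 0) (A : Set E3) :
    volume ((fun s : ℝ => b + s • e) ⁻¹' A ∩ Icc 0 1) =
      ENNReal.ofReal ‖e‖⁻¹ * μH[1] (A ∩ segment ℝ b (b + e)) := by
  have hn : 0 < ‖e‖ := norm_pos_iff.2 he
  set u := ‖e‖⁻¹ • e with hu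
  have hun : ‖u‖ = 1 := by rw [hu, norm_smul, norm_inv, norm_norm, inv_mul_cancel₀ hn.ne']
  have hue : ∀ s : ℝ, (‖e‖ * s) • u = s • e := by
    intro s
    rw [hu, smul_smul]
    congr 1
    field_simp
  have hiso : Isometry (fun t : ℝ => b + t • u) := by
    refine Isometry.of_dist_eq fun s t => ?_
    rw [dist_add_left, dist_eq_norm, ← sub_smul, norm_smul, hun, mul_one, dist_eq_norm]
  have himage : A ∩ segment ℝ b (b + e) =
      (fun t : ℝ => b + t • u) '' ((fun t : ℝ => b + t • u) ⁻¹' A ∩ Icc 0 ‖e‖) := by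
    rw [image_preimage_inter]
    congr 1
    rw [segment_eq_image']
    ext x
    simp only [mem_image, add_sub_cancel_left, mem_Icc]
    constructor
    · rintro ⟨s, ⟨h0, h1⟩, rfl⟩
      exact ⟨‖e‖ * s, ⟨by positivity, by nlinarith⟩, by rw [hue]⟩
    · rintro ⟨t, ⟨h0, h1⟩, rfl⟩
      refine ⟨t / ‖e‖, ⟨by positivity, by rwa [div_le_one hn]⟩, ?_⟩
      rw [← hue, mul_div_cancel₀ _ hn.ne']
  rw [himage, hiso.hausdorffMeasure_image (Or.inl zero_le_one), hausdorffMeasure_real]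
  have hpre : (fun s : ℝ => b + s • e) ⁻¹' A ∩ Icc 0 1 =
      (fun s : ℝ => ‖e‖ * s) ⁻¹' ((fun t : ℝ => b + t • u) ⁻¹' A ∩ Icc 0 ‖e‖) := by
    ext s
    simp only [mem_inter_iff, mem_preimage, mem_Icc, hue]
    refine and_congr_right fun _ => and_congr ?_ ?_
    · exact (mul_nonneg_iff_of_pos_left hn).symm
    · exact (mul_le_iff_le_one_right hn).symm
  rw [hpre, Real.volume_preimage_mul_left hn.ne', abs_of_pos (inv_pos.2 hn)]

lemma measurableSet_vadd_segment (v b e : E3) : MeasurableSet (v +ᵥ segment ℝ b (b + e)) := by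
  have : IsCompact (segment ℝ b (b + e)) := by
    rw [segment_eq_image']
    exact isCompact_Icc.image (by fun_prop)
  exact this.isClosed.measurableSet.const_vadd v

lemma measurable_coverCount_segment (hΛ : (Function.support Λ).Countable) (b e : E3) :
    Measurable (coverCount Λ (segment ℝ b (b + e))) := by
  have := hΛ.to_subtype
  unfold coverCount
  exact Measurable.tsum fun v =>
    (measurable_const.indicator (measurableSet_vadd_segment _ b e)).const_mul _

lemma vadd_segment_add (v b e : E3) :
    v +ᵥ segment ℝ b (b + e) = segment ℝ (v + b) (v + b + e) := by
  have := segment_translate_image ℝ v b (b + e)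
  rw [← add_assoc] at this
  rw [← this]
  rfl

/-- The measure carried by the translates of a segment has a density with respect to
one-dimensional Hausdorff measure, which counts the translates through a point. -/
lemma legMeasure_eq_withDensity (hΛ : (Function.support Λ).Countable) {b e : E3} (he : e ≠ 0) :
    legMeasure Λ b e =
      ENNReal.ofReal ‖e‖⁻¹ • (μH[1] : Measure E3).withDensity
        (coverCount Λ (segment ℝ b (b + e))) := by
  have := hΛ.to_subtype
  ext A hA
  have hm : Measurable fun p : E3 × ℝ => p.1 + b + p.2 • e := by fun_prop
  rw [legMeasure, Measure.map_apply hm hA, Measure.prod_apply (hm hA),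
    lintegral_deltaMeasure Λ (measurable_measure_prodMk_left (hm hA)), Measure.smul_apply,
    withDensity_apply _ hA, smul_eq_mul]
  unfold coverCount
  rw [lintegral_tsum, ← ENNReal.tsum_mul_left]
  · refine tsum_congr fun v => ?_
    rw [lintegral_const_mul, lintegral_indicator (measurableSet_vadd_segment _ b e), setLIntegral_one,
      Measure.restrict_apply (measurableSet_vadd_segment _ b e), mul_left_comm, vadd_segment_add,
      inter_comm _ A, ← volume_restrict_preimage_segment he, Measure.restrict_apply]
    · rfl
    · exact measurable_prodMk_left (hm hA)
    · exact measurable_const.indicator (measurableSet_vadd_segment _ b e)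
  · intro v
    exact ((measurable_const.indicator (measurableSet_vadd_segment _ b e)).const_mul _).aemeasurable

lemma exists_mem_vadd_of_coverCount_ne_zero {S : Set E3} {x : E3} (h : coverCount Λ S x ≠ 0) :
    ∃ v ∈ Function.support Λ, x ∈ v +ᵥ S := by
  by_contra! hcon
  refine h ?_
  rw [coverCount, ENNReal.tsum_eq_zero]
  intro v
  rw [indicator_of_notMem (hcon v v.2), mul_zero]

/-- Counting functions of parallel segments that agree at almost every point of each parallel line
give the same measures. -/
lemma legMeasure_add_eq (hΛ : (Function.support Λ).Countable) {b₁ b₂ b₃ b₄ e : E3} (he : e ≠ 0)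
    (h : ∀ b : E3, ∀ᵐ s : ℝ,
      coverCount Λ (segment ℝ b₁ (b₁ + e)) (b + s • e)
          + coverCount Λ (segment ℝ b₄ (b₄ + e)) (b + s • e) =
        coverCount Λ (segment ℝ b₂ (b₂ + e)) (b + s • e)
          + coverCount Λ (segment ℝ b₃ (b₃ + e)) (b + s • e)) :
    legMeasure Λ b₁ e + legMeasure Λ b₄ e = legMeasure Λ b₂ e + legMeasure Λ b₃ e := by
  have := hΛ.to_subtype
  simp only [legMeasure_eq_withDensity hΛ he, ← smul_add]
  rw [← withDensity_add_left (measurable_coverCount_segment hΛ b₁ e),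
    ← withDensity_add_left (measurable_coverCount_segment hΛ b₂ e)]
  congr 1
  refine withDensity_congr_ae ?_
  set B : Set E3 := {x | ¬ (coverCount Λ (segment ℝ b₁ (b₁ + e))
    + coverCount Λ (segment ℝ b₄ (b₄ + e))) x = (coverCount Λ (segment ℝ b₂ (b₂ + e))
    + coverCount Λ (segment ℝ b₃ (b₃ + e))) x} with hB
  have hline : ∀ b : E3, μH[1] (B ∩ range fun s : ℝ => b + s • e) = 0 := by
    intro b
    have hlip : LipschitzWith ‖e‖₊ (fun s : ℝ => b + s • e) := by
      refine LipschitzWith.of_dist_le_mul fun s t => ?_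
      rw [dist_add_left, dist_eq_norm, ← sub_smul, norm_smul, dist_eq_norm, mul_comm]
      rfl
    have h0 : μH[1] ((fun s : ℝ => b + s • e) ⁻¹' B) = 0 := by
      rw [hausdorffMeasure_real]
      exact h b
    rw [← image_preimage_eq_inter_range]
    refine le_antisymm ((hlip.hausdorffMeasure_image_le zero_le_one _).trans ?_) zero_le
    rw [h0, mul_zero]
  have hsub : B ⊆ ⋃ v : Function.support Λ, ⋃ i : Fin 4,
      B ∩ range fun s : ℝ => (v : E3) + ![b₁, b₂, b₃, b₄] i + s • e := by
    intro x hx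
    have hmem : ∀ i : Fin 4, ∀ v ∈ Function.support Λ,
        x ∈ v +ᵥ segment ℝ (![b₁, b₂, b₃, b₄] i) (![b₁, b₂, b₃, b₄] i + e) →
        x ∈ ⋃ v : Function.support Λ, ⋃ i : Fin 4,
          B ∩ range fun s : ℝ => (v : E3) + ![b₁, b₂, b₃, b₄] i + s • e := by
      intro i v hv hxv
      rw [vadd_segment_add, segment_eq_image'] at hxv
      obtain ⟨s, -, hs⟩ := hxv
      refine mem_iUnion.2 ⟨⟨v, hv⟩, mem_iUnion.2 ⟨i, hx, s, ?_⟩⟩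
      rw [← hs, add_sub_cancel_left]
    by_contra hcon
    have hz : ∀ i : Fin 4,
        coverCount Λ (segment ℝ (![b₁, b₂, b₃, b₄] i) (![b₁, b₂, b₃, b₄] i + e)) x = 0 := by
      intro i
      by_contra hne
      obtain ⟨v, hv, hxv⟩ := exists_mem_vadd_of_coverCount_ne_zero hne
      exact hcon (hmem i v hv hxv)
    have z1 := hz 0
    have z2 := hz 1
    have z3 := hz 2
    have z4 := hz 3
    simp only [Matrix.cons_val] at z1 z2 z3 z4
    exact hx (by simp only [Pi.add_apply, z1, z2, z3, z4])
  exact measure_mono_null hsub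
    (measure_iUnion_null fun v => measure_iUnion_null fun i => hline _)

/-- The power of `1 + ‖x‖` that `δ_Λ` integrates changes only by a constant factor along the
translates of a bounded segment, and it dominates a Schwartz function. -/
lemma integrable_schwartz_prod [(deltaMeasure Λ).HasTemperateGrowth] [SFinite (deltaMeasure Λ)]
    (g : 𝓢(E3, ℂ)) (b e : E3) :
    Integrable (fun p : E3 × ℝ => g (p.1 + b + p.2 • e))
      ((deltaMeasure Λ).prod (volume.restrict (Icc (0 : ℝ) 1))) := by
  set m := (deltaMeasure Λ).integrablePower with hm
  have hint := Measure.integrable_pow_neg_integrablePower (deltaMeasure Λ)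
  set C := 2 ^ m * ((Finset.Iic (m, 0)).sup fun m => SchwartzMap.seminorm ℝ m.1 m.2) g with hC
  have hg : ∀ x, (1 + ‖x‖) ^ m * ‖g x‖ ≤ C := by
    intro x
    simpa using SchwartzMap.one_add_le_sup_seminorm_apply (𝕜 := ℝ) (m := (m, 0)) (k := m) (n := 0)
      le_rfl le_rfl g x
  have hC0 : 0 ≤ C := le_trans (by positivity) (hg 0)
  have h1 : Integrable (fun p : E3 × ℝ => (C * (1 + ‖b‖ + ‖e‖) ^ m)
      * ((1 + ‖p.1‖) ^ (-(m : ℝ)) * 1))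
      ((deltaMeasure Λ).prod (volume.restrict (Icc (0 : ℝ) 1))) :=
    (hint.mul_prod (integrable_const 1)).const_mul _
  refine h1.mono' (Continuous.aestronglyMeasurable (by fun_prop)) ?_
  have hae : ∀ᵐ p : E3 × ℝ ∂((deltaMeasure Λ).prod (volume.restrict (Icc (0 : ℝ) 1))),
      p.2 ∈ Icc (0 : ℝ) 1 :=
    Measure.quasiMeasurePreserving_snd.ae (ae_restrict_mem measurableSet_Icc)
  filter_upwards [hae] with p hp
  set x := p.1 + b + p.2 • e with hx
  have hp1 : 1 + ‖p.1‖ ≤ (1 + ‖b‖ + ‖e‖) * (1 + ‖x‖) := by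
    have e1 : p.1 = x - b - p.2 • e := by rw [hx]; abel
    have e2 : ‖p.1‖ ≤ ‖x‖ + ‖b‖ + ‖e‖ := by
      rw [e1]
      refine (norm_sub_le _ _).trans (add_le_add (norm_sub_le _ _) ?_)
      rw [norm_smul, Real.norm_of_nonneg hp.1]
      nlinarith [norm_nonneg e, hp.2]
    nlinarith [norm_nonneg x, norm_nonneg b, norm_nonneg e]
  have hpow : (1 + ‖p.1‖) ^ m ≤ (1 + ‖b‖ + ‖e‖) ^ m * (1 + ‖x‖) ^ m := by
    rw [← mul_pow]
    exact pow_le_pow_left₀ (by positivity) hp1 m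
  rw [mul_one, Real.rpow_neg (by positivity), Real.rpow_natCast, ← div_eq_mul_inv,
    le_div_iff₀ (by positivity)]
  calc ‖g x‖ * (1 + ‖p.1‖) ^ m ≤ ‖g x‖ * ((1 + ‖b‖ + ‖e‖) ^ m * (1 + ‖x‖) ^ m) := by gcongr
    _ = ((1 + ‖x‖) ^ m * ‖g x‖) * (1 + ‖b‖ + ‖e‖) ^ m := by ring
    _ ≤ C * (1 + ‖b‖ + ‖e‖) ^ m := by gcongr; exact hg x

lemma integral_legMeasure [(deltaMeasure Λ).HasTemperateGrowth] [SFinite (deltaMeasure Λ)]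
    (g : 𝓢(E3, ℂ)) (b e : E3) :
    Integrable g (legMeasure Λ b e) ∧
    Integrable (fun v => ∫ s in Icc (0 : ℝ) 1, g (v + b + s • e)) (deltaMeasure Λ) ∧
    ∫ x, g x ∂legMeasure Λ b e =
      ∫ v, (∫ s in Icc (0 : ℝ) 1, g (v + b + s • e)) ∂deltaMeasure Λ := by
  have hint := integrable_schwartz_prod (Λ := Λ) g b e
  have hm : Measurable fun p : E3 × ℝ => p.1 + b + p.2 • e := by fun_prop
  have hg : AEStronglyMeasurable g (legMeasure Λ b e) := g.continuous.aestronglyMeasurable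
  refine ⟨(integrable_map_measure hg hm.aemeasurable).2 hint, hint.integral_prod_left, ?_⟩
  rw [legMeasure, integral_map hm.aemeasurable hg, integral_prod _ hint]

end LegMeasure

/-! ### The Fourier transform and its support -/

section FourierSide

open Filter Topology Set

variable {Λ : E3 → ℕ}

/-- The character `u ↦ exp (-2πi⟨y, u⟩)`. -/
noncomputable def character (y u : E3) : ℂ :=
  Complex.exp (((-2 * Real.pi * inner ℝ y u : ℝ) : ℂ) * Complex.I)

/-- The Fourier transform of the indicator function of the unit interval. -/
noncomputable def intervalFactor (t : ℝ) : ℂ :=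
  𝓕 ((Icc (0 : ℝ) 1).indicator fun _ => (1 : ℂ)) t

lemma norm_character (y u : E3) : ‖character y u‖ = 1 := Complex.norm_exp_ofReal_mul_I _

lemma character_add_left (y z u : E3) : character (y + z) u = character y u * character z u := by
  rw [character, character, character, ← Complex.exp_add, inner_add_left]
  congr 1
  push_cast
  ring

lemma continuous_character : Continuous fun p : E3 × E3 => character p.1 p.2 := by
  unfold character
  fun_prop

lemma contDiff_character (y : E3) : ContDiff ℝ ⊤ (character y) := by
  unfold character
  refine ContDiff.cexp ?_
  refine ContDiff.mul ?_ contDiff_const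
  refine Complex.ofRealCLM.contDiff.comp ?_
  exact contDiff_const.mul (contDiff_const.inner ℝ contDiff_id)

lemma contDiff_intervalFactor : ContDiff ℝ ((⊤ : ℕ∞) : WithTop ℕ∞) intervalFactor := by
  refine Real.contDiff_fourier fun n _ => ?_
  have h : (fun v : ℝ => ‖v‖ ^ n * ‖(Icc (0 : ℝ) 1).indicator (fun _ => (1 : ℂ)) v‖) =
      (Icc (0 : ℝ) 1).indicator fun v => ‖v‖ ^ n := by
    ext v
    by_cases hv : v ∈ Icc (0 : ℝ) 1
    · rw [indicator_of_mem hv, indicator_of_mem hv, norm_one, mul_one]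
    · rw [indicator_of_notMem hv, indicator_of_notMem hv, norm_zero, mul_zero]
  rw [h, integrable_indicator_iff measurableSet_Icc]
  exact (Continuous.continuousOn (by fun_prop)).integrableOn_compact isCompact_Icc

lemma intervalFactor_eq (t : ℝ) :
    intervalFactor t =
      ∫ s in Icc (0 : ℝ) 1, Complex.exp (((-2 * Real.pi * s * t : ℝ) : ℂ) * Complex.I) := by
  rw [intervalFactor, Real.fourier_real_eq_integral_exp_smul, ← integral_indicator measurableSet_Icc]
  congr 1
  ext s
  by_cases hs : s ∈ Icc (0 : ℝ) 1
  · rw [indicator_of_mem hs, indicator_of_mem hs, smul_eq_mul, mul_one]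
  · rw [indicator_of_notMem hs, indicator_of_notMem hs, smul_zero]

lemma intervalFactor_inner_eq (e u : E3) :
    intervalFactor (inner ℝ e u) = ∫ s in Icc (0 : ℝ) 1, character (s • e) u := by
  rw [intervalFactor_eq]
  refine integral_congr_ae (Eventually.of_forall fun s => ?_)
  simp only [character]
  rw [real_inner_smul_left, mul_assoc (-2 * Real.pi)]

/-- The zeros of the Fourier transform of the unit interval are the non-zero integers. -/
lemma exists_int_of_intervalFactor_eq_zero {t : ℝ} (h : intervalFactor t = 0) :
    ∃ m : ℤ, m ≠ 0 ∧ t = m := by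
  rw [intervalFactor_eq, integral_Icc_eq_integral_Ioc,
    ← intervalIntegral.integral_of_le zero_le_one] at h
  have ht : t ≠ 0 := by
    rintro rfl
    simp at h
  have hc : (((-2 * Real.pi * t : ℝ) : ℂ) * Complex.I) ≠ 0 := by
    refine mul_ne_zero ?_ Complex.I_ne_zero
    exact_mod_cast mul_ne_zero (mul_ne_zero (by norm_num) Real.pi_ne_zero) ht
  have h2 : ∀ s : ℝ, Complex.exp (((-2 * Real.pi * s * t : ℝ) : ℂ) * Complex.I) =
      Complex.exp ((((-2 * Real.pi * t : ℝ) : ℂ) * Complex.I) * s) := by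
    intro s
    congr 1
    push_cast
    ring
  simp_rw [h2] at h
  rw [integral_exp_mul_complex hc, div_eq_zero_iff] at h
  have h3 := h.resolve_right hc
  rw [Complex.ofReal_one, Complex.ofReal_zero, mul_one, mul_zero, Complex.exp_zero, sub_eq_zero,
    Complex.exp_eq_one_iff] at h3
  obtain ⟨m, hm⟩ := h3
  have h4 : ((-t : ℝ) : ℂ) = ((m : ℝ) : ℂ) := by
    have hpi : (2 * (Real.pi : ℂ) * Complex.I) ≠ 0 := Complex.two_pi_I_ne_zero
    apply mul_right_cancel₀ hpi
    push_cast at hm ⊢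
    linear_combination hm
  have h5 : -t = m := by exact_mod_cast h4
  refine ⟨-m, ?_, by push_cast; linarith⟩
  rintro h0
  have : m = 0 := by omega
  rw [this] at h5
  exact ht (by simpa using h5)

lemma exists_int_of_character_eq_one {τ u : E3} (h : character τ u = 1) :
    ∃ m : ℤ, inner ℝ τ u = m := by
  rw [character, Complex.exp_eq_one_iff] at h
  obtain ⟨m, hm⟩ := h
  have hpi : (2 * (Real.pi : ℂ) * Complex.I) ≠ 0 := Complex.two_pi_I_ne_zero
  have h4 : ((-inner ℝ τ u : ℝ) : ℂ) = ((m : ℝ) : ℂ) := by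
    apply mul_right_cancel₀ hpi
    push_cast at hm ⊢
    linear_combination hm
  have h5 : -inner ℝ τ u = (m : ℝ) := by exact_mod_cast h4
  exact ⟨-m, by push_cast; linarith⟩

lemma eq_smul_geomInverse_add {x u : E3} (hx : x ≠ 0) {t : ℝ} (h : inner ℝ x u = t) :
    ∃ w ∈ (Submodule.span ℝ {x})ᗮ, u = t • geomInverse x + w := by
  refine ⟨u - t • geomInverse x, ?_, by abel⟩
  rw [Submodule.mem_orthogonal_singleton_iff_inner_right, inner_sub_right, h, geomInverse,
    inner_smul_right, inner_smul_right, real_inner_self_eq_norm_sq]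
  have : ‖x‖ ≠ 0 := norm_ne_zero_iff.2 hx
  field_simp
  ring

/-- The Fourier transform of the signed measure on the legs `[a, a + e] + {0, τ₁, τ₂, τ₁ + τ₂}` of
a frame, where the signs are `+`, `-`, `-`, `+`. -/
noncomputable def frameFactor (a e τ₁ τ₂ u : E3) : ℂ :=
  character a u * intervalFactor (inner ℝ e u) * (1 - character τ₁ u) * (1 - character τ₂ u)

lemma contDiff_frameFactor (a e τ₁ τ₂ : E3) :
    ContDiff ℝ ((⊤ : ℕ∞) : WithTop ℕ∞) (frameFactor a e τ₁ τ₂) := by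
  have hc : ∀ y : E3, ContDiff ℝ ((⊤ : ℕ∞) : WithTop ℕ∞) (character y) := fun y =>
    (contDiff_character y).of_le le_top
  have hi : ContDiff ℝ ((⊤ : ℕ∞) : WithTop ℕ∞) fun u : E3 => intervalFactor (inner ℝ e u) :=
    contDiff_intervalFactor.comp (contDiff_const.inner ℝ contDiff_id)
  exact (((hc a).mul hi).mul (contDiff_const.sub (hc τ₁))).mul (contDiff_const.sub (hc τ₂))

lemma mem_of_frameFactor_eq_zero {a e τ₁ τ₂ u : E3} (he : e ≠ 0) (h₁ : τ₁ ≠ 0) (h₂ : τ₂ ≠ 0)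
    (h : frameFactor a e τ₁ τ₂ u = 0) : u ∈ planesNonzero e ∪ planes τ₁ ∪ planes τ₂ := by
  rw [frameFactor, mul_eq_zero, mul_eq_zero, mul_eq_zero] at h
  rcases h with ((h | h) | h) | h
  · have := norm_character a u
    rw [h, norm_zero] at this
    norm_num at this
  · obtain ⟨m, hm0, hm⟩ := exists_int_of_intervalFactor_eq_zero h
    exact Or.inl (Or.inl ⟨m, hm0, eq_smul_geomInverse_add he hm⟩)
  · obtain ⟨m, hm⟩ := exists_int_of_character_eq_one (sub_eq_zero.1 h).symm
    exact Or.inl (Or.inr ⟨m, eq_smul_geomInverse_add h₁ hm⟩)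
  · obtain ⟨m, hm⟩ := exists_int_of_character_eq_one (sub_eq_zero.1 h).symm
    exact Or.inr ⟨m, eq_smul_geomInverse_add h₂ hm⟩

lemma fourier_schwartz_apply (ψ : 𝓢(E3, ℂ)) (x : E3) :
    (𝓕 ψ) x = ∫ v, character x v * ψ v := by
  rw [SchwartzMap.fourier_coe, Real.fourier_eq']
  refine integral_congr_ae (Eventually.of_forall fun v => ?_)
  simp only [character, smul_eq_mul]
  rw [real_inner_comm]

/-- Averaging `𝓕 ψ` over a segment multiplies `ψ` by the Fourier transform of the segment. -/
lemma integral_fourier_segment (ψ : 𝓢(E3, ℂ)) (x b e : E3) :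
    Integrable (fun v => character (x + b) v * intervalFactor (inner ℝ e v) * ψ v) ∧
    ∫ s in Icc (0 : ℝ) 1, (𝓕 ψ) (x + b + s • e) =
      ∫ v, character (x + b) v * intervalFactor (inner ℝ e v) * ψ v := by
  have hint : Integrable (Function.uncurry fun (s : ℝ) (v : E3) =>
      character (x + b + s • e) v * ψ v)
      ((volume.restrict (Icc (0 : ℝ) 1)).prod (volume : Measure E3)) := by
    have h1 : Integrable (fun p : ℝ × E3 => (1 : ℝ) * ‖ψ p.2‖)
        ((volume.restrict (Icc (0 : ℝ) 1)).prod (volume : Measure E3)) :=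
      (integrable_const (1 : ℝ)).mul_prod (ψ.integrable (μ := volume)).norm
    refine h1.mono' ?_ (Eventually.of_forall fun p => ?_)
    · refine Continuous.aestronglyMeasurable ?_
      have h2 : Continuous fun p : ℝ × E3 => character (x + b + p.1 • e) p.2 :=
        continuous_character.comp
          (f := fun p : ℝ × E3 => (x + b + p.1 • e, p.2)) (by fun_prop)
      exact h2.mul (ψ.continuous.comp continuous_snd)
    · simp only [Function.uncurry, norm_mul, norm_character, le_refl]
  have hinner : ∀ v : E3, ∫ s in Icc (0 : ℝ) 1, character (x + b + s • e) v * ψ v =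
      character (x + b) v * intervalFactor (inner ℝ e v) * ψ v := by
    intro v
    rw [integral_mul_const, intervalFactor_inner_eq, ← integral_const_mul]
    simp_rw [character_add_left (x + b)]
  constructor
  · have := hint.integral_prod_right
    simpa only [Function.uncurry, hinner] using this
  · simp_rw [fourier_schwartz_apply]
    rw [integral_integral_swap hint]
    simp_rw [hinner]

/-- Multiplication by the Fourier transform of the signed measure on the legs of a frame
corresponds to taking the alternating sum of averages over the legs. -/
lemma fourier_eq_of_eq_frameFactor_mul {φ ψ : 𝓢(E3, ℂ)} {a e τ₁ τ₂ : E3}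
    (h : ∀ u, φ u = frameFactor a e τ₁ τ₂ u * ψ u) (x : E3) :
    (𝓕 φ) x = (∫ s in Icc (0 : ℝ) 1, (𝓕 ψ) (x + a + s • e))
      + (∫ s in Icc (0 : ℝ) 1, (𝓕 ψ) (x + (a + (τ₁ + τ₂)) + s • e))
      - ((∫ s in Icc (0 : ℝ) 1, (𝓕 ψ) (x + (a + τ₁) + s • e))
      + (∫ s in Icc (0 : ℝ) 1, (𝓕 ψ) (x + (a + τ₂) + s • e))) := by
  obtain ⟨i1, e1⟩ := integral_fourier_segment ψ x a e
  obtain ⟨i2, e2⟩ := integral_fourier_segment ψ x (a + (τ₁ + τ₂)) e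
  obtain ⟨i3, e3⟩ := integral_fourier_segment ψ x (a + τ₁) e
  obtain ⟨i4, e4⟩ := integral_fourier_segment ψ x (a + τ₂) e
  have hsub := integral_sub (i1.add i2) (i3.add i4)
  simp only [Pi.add_apply] at hsub
  rw [e1, e2, e3, e4, ← integral_add i1 i2, ← integral_add i3 i4, ← hsub, fourier_schwartz_apply]
  refine integral_congr_ae (Eventually.of_forall fun v => ?_)
  simp only [h, frameFactor, character_add_left]
  ring

/-- If the measures on the translates of the legs of a frame by `Λ` cancel, then `𝓕 δ_Λ` vanishes
near each point where the Fourier transform of the signed measure on the legs does not. -/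
theorem notMem_dsupport_of_frameFactor_ne_zero [(deltaMeasure Λ).HasTemperateGrowth]
    [SFinite (deltaMeasure Λ)] {a e τ₁ τ₂ u₀ : E3}
    (hleg : legMeasure Λ a e + legMeasure Λ (a + (τ₁ + τ₂)) e =
      legMeasure Λ (a + τ₁) e + legMeasure Λ (a + τ₂) e)
    (hu₀ : frameFactor a e τ₁ τ₂ u₀ ≠ 0) :
    u₀ ∉ Distribution.dsupport (𝓕 (deltaMeasure Λ).toTemperedDistribution : 𝓢'(E3, ℂ)) := by
  rw [Distribution.notMem_dsupport_iff]
  have hsmooth := contDiff_frameFactor a e τ₁ τ₂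
  refine ⟨{u | frameFactor a e τ₁ τ₂ u ≠ 0} ∩ Metric.ball u₀ 1, fun φ hφ => ?_,
    (isOpen_ne_fun hsmooth.continuous continuous_const).inter Metric.isOpen_ball,
    hu₀, Metric.mem_ball_self one_pos⟩
  have hcompact : HasCompactSupport φ :=
    (isCompact_closedBall u₀ 1).of_isClosed_subset (isClosed_tsupport _)
      ((hφ.trans inter_subset_right).trans Metric.ball_subset_closedBall)
  -- division of the test function by the non-vanishing factor
  have hquot : HasCompactSupport fun u => φ u / frameFactor a e τ₁ τ₂ u := by
    simp_rw [div_eq_mul_inv]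
    exact hcompact.mul_right
  have hquot' : ContDiff ℝ ((⊤ : ℕ∞) : WithTop ℕ∞) fun u => φ u / frameFactor a e τ₁ τ₂ u := by
    rw [contDiff_iff_contDiffAt]
    intro u
    by_cases hu : u ∈ tsupport φ
    · simp_rw [div_eq_mul_inv]
      exact (φ.smooth ⊤).contDiffAt.mul (hsmooth.contDiffAt.inv (hφ hu).1)
    · have h0 : (fun u => φ u / frameFactor a e τ₁ τ₂ u) =ᶠ[𝓝 u] fun _ => 0 := by
        filter_upwards [(isClosed_tsupport φ).isOpen_compl.mem_nhds hu] with v hv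
        rw [image_eq_zero_of_notMem_tsupport hv, zero_div]
      exact contDiffAt_const.congr_of_eventuallyEq h0
  set ψ : 𝓢(E3, ℂ) := hquot.toSchwartzMap hquot' with hψdef
  have hψ : ∀ u, φ u = frameFactor a e τ₁ τ₂ u * ψ u := by
    intro u
    change φ u = frameFactor a e τ₁ τ₂ u * (φ u / frameFactor a e τ₁ τ₂ u)
    by_cases hu : u ∈ tsupport φ
    · rw [mul_div_cancel₀ _ (hφ hu).1]
    · rw [image_eq_zero_of_notMem_tsupport hu, zero_div, mul_zero]
  obtain ⟨j1, i1, e1⟩ := integral_legMeasure (Λ := Λ) (𝓕 ψ) a e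
  obtain ⟨j2, i2, e2⟩ := integral_legMeasure (Λ := Λ) (𝓕 ψ) (a + (τ₁ + τ₂)) e
  obtain ⟨j3, i3, e3⟩ := integral_legMeasure (Λ := Λ) (𝓕 ψ) (a + τ₁) e
  obtain ⟨j4, i4, e4⟩ := integral_legMeasure (Λ := Λ) (𝓕 ψ) (a + τ₂) e
  have hsub := integral_sub (i1.add i2) (i3.add i4)
  simp only [Pi.add_apply] at hsub
  change ∫ x, (𝓕 φ) x ∂deltaMeasure Λ = 0
  simp_rw [fourier_eq_of_eq_frameFactor_mul hψ]
  rw [hsub, integral_add i1 i2, integral_add i3 i4,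
    ← e1, ← e2, ← e3, ← e4, ← integral_add_measure j1 j2, ← integral_add_measure j3 j4, hleg,
    sub_self]

end FourierSide

/-! ### Four-legged frames -/

section Frames

open Filter Topology Set

variable {P : Set E3} {Λ : E3 → ℕ} {k : ℕ}

lemma exists_isRadial_of_convex {N : StrongDual ℝ E3} {F : Set E3} (hF : Convex ℝ F)
    (hne : F.Nonempty) (hspan : ∀ u, N u = 0 → u ∈ vectorSpan ℝ F) :
    ∃ p ∈ F, IsRadial N F p := by
  obtain ⟨p, q, hq, rfl⟩ := hne.intrinsicInterior hF
  refine ⟨q, intrinsicInterior_subset ⟨q, hq, rfl⟩, fun u hu => ?_⟩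
  have hmem : ∀ t : ℝ, (q : E3) + t • u ∈ affineSpan ℝ F := by
    intro t
    rw [add_comm, ← vadd_eq_add]
    refine AffineSubspace.vadd_mem_of_mem_direction ?_ q.2
    rw [direction_affineSpan]
    exact Submodule.smul_mem _ _ (hspan u hu)
  have hcont : Continuous fun t : ℝ => (⟨(q : E3) + t • u, hmem t⟩ : affineSpan ℝ F) := by
    fun_prop
  have ht : Tendsto (fun t : ℝ => (⟨(q : E3) + t • u, hmem t⟩ : affineSpan ℝ F)) (𝓝 0) (𝓝 q) := by
    have := hcont.tendsto 0
    simpa using this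
  exact ht.eventually (mem_interior_iff_mem_nhds.1 hq)

lemma toExposed_eq_of_subset {l : StrongDual ℝ E3} {G : Set E3} (hGP : G ⊆ P)
    (hne : (l.toExposed P).Nonempty) (hsub : l.toExposed P ⊆ G) :
    l.toExposed P = l.toExposed G := by
  obtain ⟨x₀, hx₀⟩ := hne
  ext x
  constructor
  · exact fun h => ⟨hsub h, fun y hy => h.2 y (hGP hy)⟩
  · exact fun h => ⟨hGP h.1, fun y hy => (hx₀.2 y hy).trans (h.2 x₀ (hsub hx₀))⟩

/-- If a functional is on `G` a multiple of `φ` up to a constant, then the face of `P` it exposes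
within `G` is one of the two faces of `G` exposed by `φ` and `-φ`, or all of `G`. -/
lemma toExposed_eq_or {l φ : StrongDual ℝ E3} {G : Set E3} (hGP : G ⊆ P)
    (hne : (l.toExposed P).Nonempty) (hsub : l.toExposed P ⊆ G) {κ : ℝ}
    (hκ : ∀ x ∈ G, ∀ y ∈ G, l x - l y = κ * (φ x - φ y)) :
    l.toExposed P = φ.toExposed G ∨ l.toExposed P = (-φ).toExposed G ∨ l.toExposed P = G := by
  rw [toExposed_eq_of_subset hGP hne hsub]
  rcases lt_trichotomy κ 0 with h | rfl | h
  · right; left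
    ext x
    refine and_congr_right fun hx => forall₂_congr fun y hy => ?_
    have := hκ x hx y hy
    simp only [neg_apply, neg_le_neg_iff]
    constructor <;> intro h' <;> nlinarith
  · right; right
    ext x
    refine ⟨fun hx => hx.1, fun hx => ⟨hx, fun y hy => ?_⟩⟩
    have := hκ x hx y hy
    linarith
  · left
    ext x
    refine and_congr_right fun hx => forall₂_congr fun y hy => ?_
    have := hκ x hx y hy
    constructor <;> intro h' <;> nlinarith

lemma eq_zero_of_vadd_segment_eq {v a e : E3} (he : e ≠ 0)
    (h : v +ᵥ segment ℝ a (a + e) = segment ℝ a (a + e)) : v = 0 := by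
  have h1 : v + a ∈ segment ℝ a (a + e) := h ▸ ⟨a, left_mem_segment ℝ _ _, rfl⟩
  have h2 : v + (a + e) ∈ segment ℝ a (a + e) := h ▸ ⟨a + e, right_mem_segment ℝ _ _, rfl⟩
  rw [segment_eq_image'] at h1 h2
  obtain ⟨s, hs, h1⟩ := h1
  obtain ⟨t, ht, h2⟩ := h2
  simp only [add_sub_cancel_left] at h1 h2
  have hv : v = s • e := by
    rw [add_comm v a] at h1
    exact (add_left_cancel h1).symm
  have hst : (t - (s + 1)) • e = 0 := by
    rw [hv] at h2
    rw [sub_smul, add_smul, one_smul, sub_eq_zero]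
    apply add_left_cancel (a := a)
    rw [h2]; abel
  have := (smul_eq_zero.1 hst).resolve_right he
  have hs0 : s = 0 := by linarith [hs.1, ht.2]
  rw [hv, hs0, zero_smul]

/-- The kernel of the functional that exposes a facet is the direction of the facet. -/
lemma vectorSpan_facet_eq_ker {N : StrongDual ℝ E3} (hint : (interior P).Nonempty)
    (hdim : Module.finrank ℝ (vectorSpan ℝ (N.toExposed P)) = 2) :
    N ≠ 0 ∧ vectorSpan ℝ (N.toExposed P) = LinearMap.ker (N : E3 →ₗ[ℝ] ℝ) ∧
      Module.finrank ℝ (LinearMap.ker (N : E3 →ₗ[ℝ] ℝ)) = 2 := by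
  have h3 : Module.finrank ℝ E3 = 3 := by simp
  have hN : N ≠ 0 := by
    rintro rfl
    have hP : (0 : StrongDual ℝ E3).toExposed P = P := by
      ext x; simp [ContinuousLinearMap.toExposed]
    have htop : affineSpan ℝ P = ⊤ := by
      refine top_le_iff.1 ?_
      rw [← isOpen_interior.affineSpan_eq_top hint]
      exact affineSpan_mono ℝ interior_subset
    rw [hP, ← direction_affineSpan, htop, AffineSubspace.direction_top, finrank_top, h3] at hdim
    omega
  have hker : Module.finrank ℝ (LinearMap.ker (N : E3 →ₗ[ℝ] ℝ)) = 2 := by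
    have h1 := LinearMap.finrank_range_add_finrank_ker (N : E3 →ₗ[ℝ] ℝ)
    have hN' : (N : E3 →ₗ[ℝ] ℝ) ≠ 0 := by
      intro h0
      exact hN (ContinuousLinearMap.ext fun x => by simpa using LinearMap.congr_fun h0 x)
    rw [LinearMap.range_eq_top.2 (LinearMap.surjective hN'), finrank_top, h3] at h1
    simp only [Module.finrank_self] at h1
    omega
  refine ⟨hN, ?_, hker⟩
  refine Submodule.eq_of_le_of_finrank_eq ?_ (hdim.trans hker.symm)
  rw [vectorSpan, Submodule.span_le]
  rintro _ ⟨x, hx, y, hy, rfl⟩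
  have h1 := hx.2 y hy.1
  have h2 := hy.2 x hx.1
  simp only [vsub_eq_sub, SetLike.mem_coe, LinearMap.mem_ker, map_sub]
  exact sub_eq_zero.2 (le_antisymm h2 h1)

/-- In the plane `ker N`, a vector annihilated by `φ` and one that is not form a basis. -/
lemma exists_eq_smul_add_smul {N φ : StrongDual ℝ E3} {e f : E3}
    (hker : Module.finrank ℝ (LinearMap.ker (N : E3 →ₗ[ℝ] ℝ)) = 2) (he : e ≠ 0) (hNe : N e = 0)
    (hφe : φ e = 0) (hNf : N f = 0) (hφf : φ f ≠ 0) (u : E3) (hu : N u = 0) :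
    ∃ α β : ℝ, u = α • e + β • f := by
  have hli : LinearIndependent ℝ ![(⟨e, hNe⟩ : LinearMap.ker (N : E3 →ₗ[ℝ] ℝ)), ⟨f, hNf⟩] := by
    rw [LinearIndependent.pair_iff]
    intro s t hst
    have hst : s • e + t • f = 0 := by simpa using congrArg Subtype.val hst
    have h1 := congrArg φ hst
    simp only [map_add, map_smul, hφe, smul_eq_mul, mul_zero, zero_add, map_zero, mul_eq_zero] at h1
    have ht := h1.resolve_right hφf
    rw [ht, zero_smul, add_zero, smul_eq_zero] at hst
    exact ⟨hst.resolve_right he, ht⟩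
  have htop := hli.span_eq_top_of_card_eq_finrank (by simp [hker])
  have hmem : (⟨u, hu⟩ : LinearMap.ker (N : E3 →ₗ[ℝ] ℝ)) ∈ Submodule.span ℝ
      (range ![(⟨e, hNe⟩ : LinearMap.ker (N : E3 →ₗ[ℝ] ℝ)), ⟨f, hNf⟩]) := by
    rw [htop]; exact Submodule.mem_top
  rw [Matrix.range_cons, Matrix.range_cons, Matrix.range_empty, union_empty, singleton_union,
    Submodule.mem_span_pair] at hmem
  obtain ⟨α, β, h⟩ := hmem
  exact ⟨α, β, by simpa using (congrArg Subtype.val h).symm⟩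

lemma reflection_mem {c : E3} (hc : IsCenterOf c P) {x : E3} (hx : x ∈ P) : c - x + c ∈ P := by
  have : Equiv.pointReflection c x ∈ Equiv.pointReflection c '' P := mem_image_of_mem _ hx
  rw [hc] at this
  simpa [Equiv.pointReflection_apply] using this

/-- The facet opposite to the one where `N` is maximal is the one where `N` is minimal. -/
lemma pointReflection_image_toExposed {c : E3} (hc : IsCenterOf c P) (N : StrongDual ℝ E3) :
    Equiv.pointReflection c '' N.toExposed P = (-N).toExposed P := by
  ext x
  constructor
  · rintro ⟨y, hy, rfl⟩
    rw [Equiv.pointReflection_apply, vsub_eq_sub, vadd_eq_add]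
    refine ⟨reflection_mem hc hy.1, fun z hz => ?_⟩
    have := hy.2 _ (reflection_mem hc hz)
    simp only [neg_apply, map_add, map_sub] at this ⊢
    linarith
  · intro hx
    refine ⟨c - x + c, ⟨reflection_mem hc hx.1, fun z hz => ?_⟩, ?_⟩
    · have := hx.2 _ (reflection_mem hc hz)
      simp only [neg_apply, map_add, map_sub] at this ⊢
      linarith
    · rw [Equiv.pointReflection_apply, vsub_eq_sub, vadd_eq_add]
      abel

/-- The legs of a frame are the four edges of `P` singled out by two functionals: `N` is maximal on
the facet of the frame, and `φ` is minimal on the leg `[a, a + e]` and on its translate by `τ₂`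
in the opposite facet. -/
theorem IsFourLeggedFrame.exists_edgeData {e τ₁ τ₂ : E3} (h : IsFourLeggedFrame P e τ₁ τ₂)
    (hP : Convex ℝ P) (hint : (interior P).Nonempty) :
    e ≠ 0 ∧ τ₁ ≠ 0 ∧ τ₂ ≠ 0 ∧ ∃ (N φ : StrongDual ℝ E3) (a f n : E3), EdgeData P N φ e f n ∧
      (-φ).toExposed (N.toExposed P) = segment ℝ a (a + e) ∧
      φ.toExposed (N.toExposed P) = τ₁ +ᵥ segment ℝ a (a + e) ∧
      (-φ).toExposed ((-N).toExposed P) = τ₂ +ᵥ segment ℝ a (a + e) ∧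
      φ.toExposed ((-N).toExposed P) = (τ₁ + τ₂) +ᵥ segment ℝ a (a + e) := by
  obtain ⟨a, c, F, hc, ⟨hFne, hFexp, hFdim⟩, ⟨E₁, E₂, E₃, E₄⟩, ⟨hτ₁, hτ₂, -, -⟩, ⟨hF1, hF2⟩,
    ⟨hF3, hF4⟩⟩ := h
  obtain ⟨N, rfl⟩ : ∃ N : StrongDual ℝ E3, F = N.toExposed P := hFexp hFne
  rw [pointReflection_image_toExposed hc N] at hF3 hF4
  obtain ⟨hN0, hspan, hker⟩ := vectorSpan_facet_eq_ker hint hFdim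
  have hexp : ∀ L : Set E3, IsEdge P L → ∃ l : StrongDual ℝ E3, L = l.toExposed P :=
    fun L hL => hL.2.1 hL.1
  obtain ⟨l₁, hl₁⟩ := hexp _ E₁
  obtain ⟨l₂, hl₂⟩ := hexp _ E₂
  obtain ⟨l₃, hl₃⟩ := hexp _ E₃
  obtain ⟨l₄, hl₄⟩ := hexp _ E₄
  have he : e ≠ 0 := by
    rintro rfl
    have := E₁.2.2
    rw [add_zero, segment_same, vectorSpan_singleton, finrank_bot] at this
    omega
  have ha : a ∈ segment ℝ a (a + e) := left_mem_segment ℝ _ _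
  have hae : a + e ∈ segment ℝ a (a + e) := right_mem_segment ℝ _ _
  -- a functional exposing a translate of `[a, a + e]` is constant on it
  have hle : ∀ (l : StrongDual ℝ E3) (v : E3),
      v +ᵥ segment ℝ a (a + e) = l.toExposed P → l e = 0 := by
    intro l v hl
    have h1 : v + a ∈ l.toExposed P := hl ▸ ⟨a, ha, rfl⟩
    have h2 : v + (a + e) ∈ l.toExposed P := hl ▸ ⟨a + e, hae, rfl⟩
    have h3 := h1.2 _ h2.1
    have h4 := h2.2 _ h1.1
    simp only [map_add] at h3 h4
    linarith
  have hNconst : ∀ x ∈ N.toExposed P, ∀ y ∈ N.toExposed P, N (x - y) = 0 := fun x hx y hy => by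
    rw [map_sub, sub_eq_zero]
    exact le_antisymm (hy.2 x hx.1) (hx.2 y hy.1)
  have hNconst' : ∀ x ∈ (-N).toExposed P, ∀ y ∈ (-N).toExposed P, N (x - y) = 0 :=
    fun x hx y hy => by
      have h1 := hx.2 y hy.1
      have h2 := hy.2 x hx.1
      simp only [neg_apply, neg_le_neg_iff] at h1 h2
      rw [map_sub, sub_eq_zero]
      exact le_antisymm h1 h2
  have hNe : N e = 0 := by simpa using hNconst _ (hF1 hae) _ (hF1 ha)
  -- an edge cannot contain a facet
  have hdim : ∀ L : Set E3, IsEdge P L → ¬ N.toExposed P ⊆ L := by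
    intro L hL hsub
    have h1 := Submodule.finrank_mono (vectorSpan_mono ℝ hsub)
    rw [hFdim, hL.2.2] at h1
    omega
  set φ : StrongDual ℝ E3 := -l₁ with hφdef
  have hφe : φ e = 0 := by
    have := hle l₁ 0 (by rw [zero_vadd]; exact hl₁)
    simp [hφdef, this]
  have hE1 : (-φ).toExposed (N.toExposed P) = segment ℝ a (a + e) := by
    rw [hφdef, neg_neg, hl₁]
    rw [hl₁] at hF1 ha
    exact (toExposed_eq_of_subset (fun x hx => hx.1) ⟨a, ha⟩ hF1).symm
  obtain ⟨f, hNf, hφf⟩ : ∃ f, N f = 0 ∧ 0 < φ f := by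
    obtain ⟨f, hf, hf'⟩ : ∃ f, N f = 0 ∧ φ f ≠ 0 := by
      by_contra! hcon
      refine hdim _ E₁ fun x hx => ?_
      rw [← hE1]
      have hx' : ∀ y ∈ N.toExposed P, φ x = φ y := fun y hy => by
        simpa [sub_eq_zero] using hcon _ (hNconst x hx y hy)
      exact ⟨hx, fun y hy => by simp [hx' y hy]⟩
    rcases lt_or_gt_of_ne hf' with h | h
    · exact ⟨-f, by simp [hf], by simpa using h⟩
    · exact ⟨f, hf, h⟩
  have hbasis := exists_eq_smul_add_smul hker he hNe hφe hNf hφf.ne'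
  -- on `ker N`, a functional that annihilates `e` is a multiple of `φ`
  have hmul : ∀ l : StrongDual ℝ E3, l e = 0 → ∀ x y : E3, N (x - y) = 0 →
      l x - l y = l f / φ f * (φ x - φ y) := by
    intro l hl x y hxy
    obtain ⟨α, β, h⟩ := hbasis _ hxy
    have h1 := congrArg l h
    have h2 := congrArg φ h
    simp only [map_sub, map_add, map_smul, hl, hφe, smul_eq_mul, mul_zero, zero_add] at h1 h2
    rw [h1, h2]
    field_simp
  have hE2 : φ.toExposed (N.toExposed P) = τ₁ +ᵥ segment ℝ a (a + e) := by
    have hne : (l₂.toExposed P).Nonempty := hl₂ ▸ E₂.1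
    rcases toExposed_eq_or (φ := φ) (fun x hx => hx.1) hne (hl₂ ▸ hF2)
      (fun x hx y hy => hmul l₂ (hle l₂ τ₁ hl₂) x y (hNconst x hx y hy)) with h | h | h
    · rw [← h, hl₂]
    · rw [← hl₂, hE1] at h
      exact absurd (eq_zero_of_vadd_segment_eq he h) hτ₁
    · rw [← hl₂] at h
      exact absurd h.symm.subset (hdim _ E₂)
  have hφτ : 0 < φ τ₁ := by
    by_contra! hle0
    refine hdim _ E₁ fun x hx => ?_
    rw [← hE1]
    refine ⟨hx, fun y hy => ?_⟩
    have h1 : a ∈ (-φ).toExposed (N.toExposed P) := hE1 ▸ ha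
    have h2 : τ₁ + a ∈ φ.toExposed (N.toExposed P) := hE2 ▸ ⟨a, ha, rfl⟩
    have h3 := h1.2 y hy
    have h4 := h2.2 x hx
    simp only [neg_apply, neg_le_neg_iff, map_add] at h3 h4 ⊢
    linarith
  have hp3 : τ₂ + a ∈ τ₂ +ᵥ segment ℝ a (a + e) := ⟨a, ha, rfl⟩
  have hp4 : τ₁ + τ₂ + a ∈ (τ₁ + τ₂) +ᵥ segment ℝ a (a + e) := ⟨a, ha, rfl⟩
  have hφE : ∀ x ∈ segment ℝ a (a + e), φ x = φ a := by
    intro x hx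
    rw [segment_eq_image'] at hx
    obtain ⟨s, -, rfl⟩ := hx
    simp [hφe]
  have hE3 : (-φ).toExposed ((-N).toExposed P) = τ₂ +ᵥ segment ℝ a (a + e) := by
    have hne : (l₃.toExposed P).Nonempty := hl₃ ▸ E₃.1
    rcases toExposed_eq_or (φ := φ) (fun x hx => hx.1) hne (hl₃ ▸ hF3)
      (fun x hx y hy => hmul l₃ (hle l₃ τ₂ hl₃) x y (hNconst' x hx y hy)) with h | h | h
    · rw [← hl₃] at h
      rw [h] at hp3
      have := hp3.2 _ (hF4 hp4)
      simp only [map_add] at this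
      linarith
    · rw [← h, hl₃]
    · rw [← hl₃] at h
      obtain ⟨x, hx, hx'⟩ : τ₁ + τ₂ + a ∈ τ₂ +ᵥ segment ℝ a (a + e) := h ▸ hF4 hp4
      have := congrArg φ hx'
      simp only [vadd_eq_add, map_add, hφE x hx] at this
      linarith
  have hE4 : φ.toExposed ((-N).toExposed P) = (τ₁ + τ₂) +ᵥ segment ℝ a (a + e) := by
    have hne : (l₄.toExposed P).Nonempty := hl₄ ▸ E₄.1
    rcases toExposed_eq_or (φ := φ) (fun x hx => hx.1) hne (hl₄ ▸ hF4)
      (fun x hx y hy => hmul l₄ (hle l₄ _ hl₄) x y (hNconst' x hx y hy)) with h | h | h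
    · rw [← h, hl₄]
    · rw [← hl₄] at h
      rw [h] at hp4
      have := hp4.2 _ (hF3 hp3)
      simp only [neg_apply, map_add] at this
      linarith
    · rw [← hl₄] at h
      obtain ⟨x, hx, hx'⟩ : τ₂ + a ∈ (τ₁ + τ₂) +ᵥ segment ℝ a (a + e) := h ▸ hF3 hp3
      have := congrArg φ hx'
      simp only [vadd_eq_add, map_add, hφE x hx] at this
      linarith
  obtain ⟨n, hn⟩ : ∃ n, 0 < N n := by
    by_contra! hcon
    refine hN0 (ContinuousLinearMap.ext fun x => le_antisymm (hcon x) ?_)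
    simpa using hcon (-x)
  obtain ⟨p, hpF, hp⟩ := exists_isRadial_of_convex (N := N) (hFexp.convex hP) hFne
    (fun u hu => by rw [hspan]; exact hu)
  have hpP : IsRadial N P p := fun u hu => (hp u hu).mono fun t ht => ht.1
  refine ⟨he, hτ₁, hτ₂, N, φ, a, f, n, ⟨hNe, hNf, hn, hφe, hφf, hbasis, ⟨p, hpF, hpP⟩, ?_⟩,
    hE1, hE2, hE3, hE4⟩
  refine ⟨c - p + c, ?_, fun u hu => ?_⟩
  · rw [← pointReflection_image_toExposed hc]
    exact ⟨p, hpF, rfl⟩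
  · filter_upwards [hpP (-u) (by simp [hu])] with t ht
    convert reflection_mem hc ht using 1
    module

end Frames

theorem mainTheorem5 (P : Set E3) (Λ : E3 → ℕ) (k : ℕ)
    (hP : IsPolytope P)
    (hsymm : IsCentrallySymmetric P)
    (hfacets : ∀ F : Set E3, IsFacet P F → IsCentrallySymmetric F)
    (hk : 0 < k)
    (htile : TilesAtLevel P Λ k) :
    ∃ _ : (deltaMeasure Λ).HasTemperateGrowth,
      Distribution.dsupport (𝓕 (deltaMeasure Λ).toTemperedDistribution : 𝓢'(E3, ℂ)) ⊆
        {0} ∪ ⋂ (e : E3) (τ₁ : E3) (τ₂ : E3) (_ : IsFourLeggedFrame P e τ₁ τ₂),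
          (planesNonzero e ∪ planes τ₁ ∪ planes τ₂) := by
  obtain ⟨⟨V, hV, hPV⟩, hint⟩ := hP
  have hconv : Convex ℝ P := hPV ▸ convex_convexHull ℝ V
  have hcpt : IsCompact P := by rw [hPV]; exact hV.isCompact_convexHull (𝕜 := ℝ)
  have hgrowth := htile.hasTemperateGrowth hcpt hint
  have hsf := htile.sFinite_deltaMeasure hint
  refine ⟨hgrowth, fun u hu => Or.inr ?_⟩
  simp only [Set.mem_iInter]
  intro e τ₁ τ₂ hframe
  obtain ⟨he, hτ₁, hτ₂, N, φ, a, f, n, hd, hE1, hE2, hE3, hE4⟩ :=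
    hframe.exists_edgeData hconv hint
  have hleg : legMeasure Λ a e + legMeasure Λ (a + (τ₁ + τ₂)) e =
      legMeasure Λ (a + τ₁) e + legMeasure Λ (a + τ₂) e := by
    refine legMeasure_add_eq (htile.countable_support hint) he fun b => ?_
    have := htile.ae_coverCount_add_eq hconv hcpt hint hd b
    simp only [hE1, hE2, hE3, hE4, vadd_segment_add] at this
    rwa [add_comm a (τ₁ + τ₂), add_comm a τ₁, add_comm a τ₂]
  by_contra hnot
  exact notMem_dsupport_of_frameFactor_ne_zero hleg
    (fun h0 => hnot (mem_of_frameFactor_eq_zero he hτ₁ hτ₂ h0)) hu
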